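/- Let \(G\) be a profinite group, \(X\) a profinite space with a continuous action of \(G\), and \(R\) a ring with unit. A \(G\)-sheaf of \(R\)-modules over \(X\) is a \(G\)-equivariant local homeomorphism \(p\colon E\to X\) of spaces with continuous \(G\)-actions, with \(R\)-module structures on the fibres \(E_x=p^{-1}(x)\) whose operations \((e,e')\mapsto e-e'\) (on \(E\times_X E\)) and \(e\mapsto re\) are continuous, such that each \(g\colon E_x\to E_{gx}\) is \(R\)-linear; maps are continuous equivariant maps over \(X\) that are \(R\)-linear on fibres. For a basis \(\mathcal B\) of the topology of \(X\) consisting of open-closed sets, let \(\mathcal O_G(\mathcal B)\) be the category with objects the elements of \(\mathcal B\) and morphisms \(U\to V\) the elements \(g\in G\) with \(gU\subseteq V\). A \(G\)-presheaf of \(R\)-modules over \(\mathcal B\) is a functor \(F\colon\mathcal O_G(\mathcal B)^{\mathrm{op}}\to R\text{-mod}\) such that for every \(U\) each element of \(F(U)\) is fixed by an open subgroup of \(\mathrm{stab}_G(U)=\{g\mid gU=U\}\) (that is, \(\mathrm{stab}_G(U)\) acts continuously on the discrete set \(F(U)\)); maps are natural transformations. A \(G\)-sheaf \(E\) has an underlying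 \(G\)-presheaf \(U\mapsto\Gamma(U,E)\) of continuous sections, on which \(g\) with \(gV\subseteq U\) acts by \(s\mapsto(v\mapsto g^{-1}s(gv))\). The sheafification \(\ell F\) of a \(G\)-presheaf \(F\) has total space \(\coprod_{x\in X}F_x\), with the topology generated by the sets \(\{s_x\mid x\in U\}\) for \(U\in\mathcal B\), \(s\in F(U)\), and with the action \(g(s_x)=(g*s)_{gx}\), where \(g*s\) is the image of \(s\) under (restrictions of) \(F(g^{-1})\). For a \(G\)-sheaf \(E\) there is a canonical map \(\varepsilon_E\colon\ell E\to E\), \(s_x\mapsto s(x)\). Write \(\mathrm{disc}\,M\) for the submodule of elements of \(M\) fixed by some open subgroup of the group acting on \(M\). Then the following hold. 1. The category of \(G\)-sheaves of \(R\)-modules over \(X\) is abelian, with the addition of maps defined fibrewise. 2. It has all small limits and all small colimits. 3. Let \(\mathcal B\) be an open-closed basis and \(D\) a small diagram \((D_j)_{j\in J}\) of \(G\)-sheaves. Then there is a cocone on the diagram of underlying \(G\)-presheaves over \(\mathcal B\) that is termwise a colimit, i.e. whose value at each \(U\in\mathcal B\) is a colimit of the \(R\)-modules \(D_j(U)\).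 Every such cocone \((c_j\colon D_j\to C)_j\) is a colimit in the category of \(G\)-presheaves, and \(\ell C\) is the colimit of \(D\) in the category of \(G\)-sheaves, with structure maps \(\iota_j\colon D_j\to\ell C\) satisfying \(\iota_j\circ\varepsilon_{D_j}=\ell(c_j)\). 4. Let \(\mathcal B\) be an open-closed basis and \((F_i)_{i\in I}\) a family of \(G\)-sheaves indexed by a set. The \(G\)-presheaf \(\prod^P_iF_i\colon U\mapsto\mathrm{disc}\prod_iF_i(U)\) over \(\mathcal B\), with its projections, is the product of the \(F_i\) in the category of \(G\)-presheaves, and \(\ell\prod^P_iF_i\), with the projections \(\varepsilon_{F_i}\circ\ell(\mathrm{pr}_i)\), is the product of the \(F_i\) in the category of \(G\)-sheaves. 5. The product in 4 does not depend on the basis: for open-closed bases \(\mathcal B,\mathcal B'\) and a set \(I\), there is an isomorphism, natural in \((F_i)_{i\in I}\) and compatible with the projections to the \(F_i\), between the \(G\)-sheaves \(\ell\prod^P_iF_i\) formed with \(\mathcal B\) and with \(\mathcal B'\). -/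

import Mathlib

open CategoryTheory CategoryTheory.Limits Opposite TopologicalSpace Topology
open scoped Pointwise

universe u

set_option linter.unusedSectionVars false

noncomputable section

/-! ## Equivariant sheaves of modules, as sheaf spaces -/

/-- A `G`-equivariant sheaf of `R`-modules over the `G`-space `X`: a local homeomorphism
`p : E → X` which is an equivariant map of spaces with continuous `G`-action, whose fibres are
`R`-modules with fibrewise continuous operations, and such that each
`g : p ⁻¹ x → p ⁻¹ (g x)` is a map of `R`-modules. -/
structure GSheaf (G X R : Type u) [Group G] [TopologicalSpace G] [TopologicalSpace X]
    [MulAction G X] [Ring R] where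
  /-- the total space -/
  E : Type u
  [topE : TopologicalSpace E]
  [actE : MulAction G E]
  [contE : ContinuousSMul G E]
  /-- the projection -/
  p : E → X
  isLocalHomeomorph : IsLocalHomeomorph p
  p_smul : ∀ (g : G) (e : E), p (g • e) = g • p e
  [fibreGroup : ∀ x : X, AddCommGroup {e : E // p e = x}]
  [fibreModule : ∀ x : X, Module R {e : E // p e = x}]
  continuous_fibreSub : Continuous fun q : {q : E × E // p q.2 = p q.1} =>
    (((⟨q.1.1, rfl⟩ : {e : E // p e = p q.1.1}) - ⟨q.1.2, q.2⟩ : {e : E // p e = p q.1.1}) : E)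
  continuous_fibreSMul : ∀ r : R, Continuous fun e : E =>
    ((r • (⟨e, rfl⟩ : {e' : E // p e' = p e}) : {e' : E // p e' = p e}) : E)
  isLinearMap_smul : ∀ (g : G) (x : X), IsLinearMap R
    (fun a : {e : E // p e = x} =>
      (⟨g • a.1, (p_smul g a.1).trans (congrArg (g • ·) a.2)⟩ : {e : E // p e = g • x}))

attribute [instance] GSheaf.topE GSheaf.actE GSheaf.contE GSheaf.fibreGroup GSheaf.fibreModule

section Sheaves

variable {G X R : Type u} [Group G] [TopologicalSpace G] [TopologicalSpace X]
  [MulAction G X] [Ring R]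

namespace GSheaf

/-- The fibre (equivalently, the stalk) of a sheaf space at `x`. -/
abbrev Fibre (A : GSheaf G X R) (x : X) : Type u := {e : A.E // A.p e = x}

/-- A map of `G`-sheaves of `R`-modules: a continuous equivariant map over `X` which is
`R`-linear on each fibre. -/
@[ext]
structure Hom (A B : GSheaf G X R) where
  toFun : A.E → B.E
  continuous_toFun : Continuous toFun
  p_toFun : ∀ e, B.p (toFun e) = A.p e
  map_smul : ∀ (g : G) (e : A.E), toFun (g • e) = g • toFun e
  isLinearMap_fibre : ∀ x : X, IsLinearMap R
    (fun a : A.Fibre x => (⟨toFun a.1, (p_toFun a.1).trans a.2⟩ : B.Fibre x))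

/-- The `R`-linear map induced on fibres. -/
def Hom.fibreMap {A B : GSheaf G X R} (f : Hom A B) (x : X) : A.Fibre x →ₗ[R] B.Fibre x :=
  (f.isLinearMap_fibre x).mk' _

instance : Category.{u} (GSheaf G X R) where
  Hom A B := Hom A B
  id A :=
    { toFun := id
      continuous_toFun := continuous_id
      p_toFun := fun _ => rfl
      map_smul := fun _ _ => rfl
      isLinearMap_fibre := fun _ => ⟨fun _ _ => rfl, fun _ _ => rfl⟩ }
  comp f g :=
    { toFun := g.toFun ∘ f.toFun
      continuous_toFun := g.continuous_toFun.comp f.continuous_toFun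
      p_toFun := fun e => (g.p_toFun _).trans (f.p_toFun e)
      map_smul := fun a e => by simp [f.map_smul, g.map_smul]
      isLinearMap_fibre := fun x => ((g.fibreMap x).comp (f.fibreMap x)).isLinear }

@[ext]
theorem hom_ext {A B : GSheaf G X R} {f g : A ⟶ B} (h : ∀ e, f.toFun e = g.toFun e) : f = g :=
  Hom.ext (funext h)

@[simp] theorem id_toFun (A : GSheaf G X R) (e : A.E) : Hom.toFun (𝟙 A) e = e := rfl

@[simp] theorem comp_toFun {A B C : GSheaf G X R} (f : A ⟶ B) (g : B ⟶ C) (e : A.E) :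
    Hom.toFun (f ≫ g) e = g.toFun (f.toFun e) := rfl

variable (A : GSheaf G X R)

theorem continuous_p : Continuous A.p := A.isLocalHomeomorph.continuous

theorem fibre_congr {x y : X} (h : x = y) (a b : A.Fibre x) (a' b' : A.Fibre y)
    (ha : a.1 = a'.1) (hb : b.1 = b'.1) : (a - b).1 = (a' - b').1 := by
  subst h
  rw [Subtype.ext ha, Subtype.ext hb]

theorem fibre_add_congr {x y : X} (h : x = y) (a b : A.Fibre x) (a' b' : A.Fibre y)
    (ha : a.1 = a'.1) (hb : b.1 = b'.1) : (a + b).1 = (a' + b').1 := by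
  subst h
  rw [Subtype.ext ha, Subtype.ext hb]

theorem fibre_smul_congr {x y : X} (h : x = y) (r : R) (a : A.Fibre x) (a' : A.Fibre y)
    (ha : a.1 = a'.1) : (r • a).1 = (r • a').1 := by
  subst h
  rw [Subtype.ext ha]

theorem continuous_sub_of {T : Type u} [TopologicalSpace T] {π : T → X}
    (a b : ∀ t, A.Fibre (π t)) (ha : Continuous fun t => (a t).1)
    (hb : Continuous fun t => (b t).1) : Continuous fun t => (a t - b t).1 := by
  have h := A.continuous_fibreSub.comp
    (f := fun t => (⟨((a t).1, (b t).1), (b t).2.trans (a t).2.symm⟩ :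
      {q : A.E × A.E // A.p q.2 = A.p q.1})) ((ha.prodMk hb).subtype_mk _)
  refine h.congr fun t => ?_
  exact A.fibre_congr (a t).2 _ _ _ _ rfl rfl

theorem continuous_smul_of {T : Type u} [TopologicalSpace T] {π : T → X} (r : R)
    (a : ∀ t, A.Fibre (π t)) (ha : Continuous fun t => (a t).1) :
    Continuous fun t => (r • a t).1 := by
  refine ((A.continuous_fibreSMul r).comp ha).congr fun t => ?_
  exact A.fibre_smul_congr (a t).2 _ _ _ rfl

theorem exists_local_section (e : A.E) : ∃ (U : Set X) (s : ∀ u : U, A.Fibre u.1),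
    IsOpen U ∧ (Continuous fun u => (s u).1) ∧ ∃ h : A.p e ∈ U, (s ⟨A.p e, h⟩).1 = e := by
  obtain ⟨f, hf, hp⟩ := A.isLocalHomeomorph e
  refine ⟨f.target, fun u => ⟨f.symm u.1, ?_⟩, f.open_target, ?_, ?_, ?_⟩
  · rw [hp]; exact f.right_inv u.2
  · exact f.continuousOn_symm.domRestrict
  · rw [hp]; exact f.map_source hf
  · simp only [hp]; exact f.left_inv hf

theorem continuous_zero : Continuous fun x : X => (0 : A.Fibre x).1 := by
  rw [continuous_iff_continuousAt]
  intro x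
  obtain ⟨U, s, hU, hs, hx, -⟩ := A.exists_local_section (0 : A.Fibre x).1
  rw [(0 : A.Fibre x).2] at hx
  have h : Continuous fun u : U => (0 : A.Fibre u.1).1 := by
    have := A.continuous_sub_of (π := fun u : U => u.1) s s hs hs
    simpa using this
  exact (continuousOn_iff_continuous_domRestrict.2 h).continuousAt (hU.mem_nhds hx)

/-- The `R`-module `Γ(U, E)` of (continuous, not necessarily equivariant) sections over `U`. -/
def sections (U : Set X) : Submodule R (∀ x : U, A.Fibre x.1) where
  carrier := {s | Continuous fun x => (s x).1}
  zero_mem' := A.continuous_zero.comp continuous_subtype_val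
  add_mem' {a b} ha hb := by
    have h0 : Continuous fun x : U => (0 : A.Fibre x.1).1 :=
      A.continuous_zero.comp continuous_subtype_val
    have h1 := A.continuous_sub_of (π := fun u : U => u.1) _ b h0 hb
    have h2 := A.continuous_sub_of (π := fun u : U => u.1) a _ ha h1
    simpa using h2
  smul_mem' r a ha := A.continuous_smul_of (π := fun u : U => u.1) r a ha

theorem section_congr {U : Set X} (s : A.sections U) {x y : U} (h : x = y) :
    (s.1 x).1 = (s.1 y).1 := by rw [h]

end GSheaf

/-! ## Equivariant presheaves over an open-closed basis -/

/-- An open-closed basis of the topology of `X`. -/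
structure ClopenBasis (X : Type u) [TopologicalSpace X] where
  sets : Set (Set X)
  isBasis : IsTopologicalBasis sets
  isClopen : ∀ U ∈ sets, IsClopen U

/-- The category `O_G(B)`: objects are the members of the basis, and maps `U ⟶ V` are the
`g : G` with `g U ⊆ V`. -/
structure OrbitCat (G : Type u) {X : Type u} [TopologicalSpace X] (B : ClopenBasis X) where
  set : Set X
  mem : set ∈ B.sets

namespace OrbitCat

variable {B : ClopenBasis X}

instance : Category.{u} (OrbitCat G B) where
  Hom U V := {g : G // g • U.set ⊆ V.set}
  id U := ⟨1, by rw [one_smul]⟩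
  comp f g := ⟨g.1 * f.1, by
    rw [mul_smul]; exact (Set.smul_set_mono f.2).trans g.2⟩
  id_comp f := Subtype.ext (mul_one _)
  comp_id f := Subtype.ext (one_mul _)
  assoc f g h := Subtype.ext (mul_assoc _ _ _).symm

/-- The map `U ⟶ V` given by a group element `g` with `g U ⊆ V`. -/
def homMk {U V : OrbitCat G B} (g : G) (h : g • U.set ⊆ V.set) : U ⟶ V := ⟨g, h⟩

/-- The endomorphism of `U` given by an element of `stab_G(U) = {g | g U = U}`. -/
def ofStab {U : OrbitCat G B} (g : MulAction.stabilizer G U.set) : U ⟶ U :=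
  homMk g.1 (MulAction.mem_stabilizer_iff.1 g.2).subset

theorem isOpen (U : OrbitCat G B) : IsOpen U.set := (B.isClopen _ U.mem).isOpen

end OrbitCat

/-- The subgroup of `stab_G(U)` of elements fixing a given `s ∈ F(U)`. -/
def fixingSubgroupOf {B : ClopenBasis X} (F : (OrbitCat G B)ᵒᵖ ⥤ ModuleCat.{u} R)
    (U : OrbitCat G B) (s : F.obj (op U)) : Subgroup (MulAction.stabilizer G U.set) where
  carrier := {g | (F.map (OrbitCat.ofStab g).op).hom s = s}
  one_mem' := by
    have e := congrArg (fun k => k.hom s) (F.map_id (op U))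
    exact e
  mul_mem' {a b} ha hb := by
    have e := congrArg (fun k => k.hom s) (F.map_comp
      (OrbitCat.ofStab a).op (OrbitCat.ofStab b).op)
    simp only [ModuleCat.hom_comp, LinearMap.comp_apply] at e
    change (F.map (OrbitCat.ofStab a).op).hom s = s at ha
    rw [ha] at e
    exact e.trans hb
  inv_mem' {a} ha := by
    have e := congrArg (fun k => k.hom s) (F.map_comp
      (OrbitCat.ofStab a).op (OrbitCat.ofStab a⁻¹).op)
    have e' : (OrbitCat.ofStab a).op ≫ (OrbitCat.ofStab a⁻¹).op = 𝟙 (op U) :=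
      Quiver.Hom.unop_inj (Subtype.ext (mul_inv_cancel a.1))
    rw [e', F.map_id] at e
    simp only [ModuleCat.hom_comp, LinearMap.comp_apply, ModuleCat.hom_id,
      LinearMap.id_apply] at e
    change (F.map (OrbitCat.ofStab a).op).hom s = s at ha
    rw [ha] at e
    exact e.symm

/-- For a functor `F : O_G(B)ᵒᵖ ⥤ R-mod`, the discrete part `disc F(U)` of `F(U)`: the elements
fixed by some open subgroup of `stab_G(U)`. -/
def discPart {B : ClopenBasis X} (F : (OrbitCat G B)ᵒᵖ ⥤ ModuleCat.{u} R) (U : OrbitCat G B) :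
    Submodule R (F.obj (op U)) where
  carrier := {s | ∃ H : Subgroup (MulAction.stabilizer G U.set), IsOpen (H : Set (MulAction.stabilizer G U.set)) ∧
    ∀ h ∈ H, (F.map (OrbitCat.ofStab h).op).hom s = s}
  zero_mem' := ⟨⊤, isOpen_univ, fun _ _ => map_zero _⟩
  add_mem' := by
    rintro a b ⟨H, hH, ha⟩ ⟨K, hK, hb⟩
    exact ⟨H ⊓ K, hH.inter hK, fun h hh => by rw [map_add, ha h hh.1, hb h hh.2]⟩
  smul_mem' := by
    rintro r a ⟨H, hH, ha⟩
    exact ⟨H, hH, fun h hh => by rw [_root_.map_smul, ha h hh]⟩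

/-- The functors `F : O_G(B)ᵒᵖ ⥤ R-mod` such that `stab_G(U)` acts continuously on `F(U)` with
its discrete topology, that is, each element of `F(U)` is fixed by some open subgroup of
`stab_G(U)`. -/
def IsDiscretePresheaf (G R : Type u) {X : Type u} [Group G] [TopologicalSpace G]
    [TopologicalSpace X] [MulAction G X] [Ring R] (B : ClopenBasis X) :
    ObjectProperty ((OrbitCat G B)ᵒᵖ ⥤ ModuleCat.{u} R) :=
  fun F => ∀ (U : OrbitCat G B) (s : F.obj (op U)), s ∈ discPart F U

/-- The category of `G`-equivariant presheaves of `R`-modules over `B`; maps are natural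
transformations. -/
abbrev GPresheaf (G R : Type u) {X : Type u} [Group G] [TopologicalSpace G]
    [TopologicalSpace X] [MulAction G X] [Ring R] (B : ClopenBasis X) :=
  (IsDiscretePresheaf G R B).FullSubcategory


section Stabilizers

theorem eventually_smul_mem [ContinuousSMul G X] {U : Set X} (hc : IsCompact U)
    (ho : IsOpen U) : ∀ᶠ g : G in 𝓝 1, ∀ x ∈ U, g • x ∈ U := by
  refine hc.eventually_forall_of_forall_eventually fun x hx => ?_
  have h : Continuous fun q : G × X => q.1 • q.2 := by fun_prop
  exact h.continuousAt.eventually (ho.mem_nhds (show (1 : G) • x ∈ U by simpa using hx))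

theorem isOpen_stabilizer [IsTopologicalGroup G] [ContinuousSMul G X] {U : Set X}
    (hc : IsCompact U) (ho : IsOpen U) :
    IsOpen (MulAction.stabilizer G U : Set G) := by
  refine Subgroup.isOpen_of_mem_nhds _ (g := 1) ?_
  have h1 := eventually_smul_mem (G := G) hc ho
  have h2 : ∀ᶠ g : G in 𝓝 1, ∀ x ∈ U, g⁻¹ • x ∈ U := by
    have : Filter.Tendsto (fun g : G => g⁻¹) (𝓝 1) (𝓝 1) := by
      simpa using (continuous_inv (G := G)).tendsto 1
    exact this.eventually h1
  filter_upwards [h1, h2] with g hg hg'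
  rw [SetLike.mem_coe, MulAction.mem_stabilizer_iff]
  refine Set.Subset.antisymm ?_ ?_
  · rintro _ ⟨x, hx, rfl⟩; exact hg x hx
  · intro x hx; exact Set.mem_smul_set_iff_inv_smul_mem.2 (hg' x hx)

end Stabilizers

section Disc

variable [IsTopologicalGroup G] [ContinuousSMul G X] [CompactSpace X] {B : ClopenBasis X}

theorem OrbitCat.isOpen_stabilizer (U : OrbitCat G B) :
    IsOpen (MulAction.stabilizer G U.set : Set G) :=
  _root_.isOpen_stabilizer (B.isClopen _ U.mem).isClosed.isCompact U.isOpen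

theorem map_mem_discPart (F : (OrbitCat G B)ᵒᵖ ⥤ ModuleCat.{u} R) {U V : OrbitCat G B}
    (f : V ⟶ U) {s : F.obj (op U)} (hs : s ∈ discPart F U) :
    (F.map f.op).hom s ∈ discPart F V := by
  obtain ⟨H, hH, hs⟩ := hs
  have hH' : IsOpen ((H.map (Subgroup.subtype _) : Subgroup G) : Set G) :=
    U.isOpen_stabilizer.isOpenMap_subtype_val _ hH
  refine ⟨((H.map (Subgroup.subtype _)).comap (MulAut.conj f.1).toMonoidHom).comap
    (Subgroup.subtype _), ?_, ?_⟩
  · have : Continuous fun n : MulAction.stabilizer G V.set => f.1 * n.1 * f.1⁻¹ := by fun_prop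
    exact hH'.preimage this
  · rintro n ⟨h, hh, hn⟩
    have hn' : h.1 = f.1 * n.1 * f.1⁻¹ := hn
    have e : OrbitCat.ofStab n ≫ f = f ≫ OrbitCat.ofStab h := by
      apply Subtype.ext
      change f.1 * n.1 = h.1 * f.1
      rw [hn']; group
    have e' := congrArg (fun k => (F.map k.op).hom s) e
    simp only [op_comp, F.map_comp, ModuleCat.hom_comp, LinearMap.comp_apply] at e'
    rw [e', hs h hh]

theorem hom_mem_discPart {F F' : (OrbitCat G B)ᵒᵖ ⥤ ModuleCat.{u} R} (φ : F ⟶ F')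
    {U : OrbitCat G B} {s : F.obj (op U)} (hs : s ∈ discPart F U) :
    (φ.app (op U)).hom s ∈ discPart F' U := by
  obtain ⟨H, hH, hs⟩ := hs
  refine ⟨H, hH, fun h hh => ?_⟩
  have e := congrArg (fun k => k.hom s) (φ.naturality (OrbitCat.ofStab h).op)
  simp only [ModuleCat.hom_comp, LinearMap.comp_apply] at e
  rw [← e, hs h hh]

/-- The subfunctor `U ↦ disc F(U)` of `F`. -/
def discFunctorObj (F : (OrbitCat G B)ᵒᵖ ⥤ ModuleCat.{u} R) :
    (OrbitCat G B)ᵒᵖ ⥤ ModuleCat.{u} R where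
  obj U := ModuleCat.of R (discPart F U.unop)
  map f := ModuleCat.ofHom
    ((F.map f).hom.restrict fun _ hs => map_mem_discPart F f.unop hs)
  map_id U := by
    ext s
    change (F.map (𝟙 U)).hom s.1 = s.1
    simp
  map_comp f g := by
    ext s
    change (F.map (f ≫ g)).hom s.1 = (F.map g).hom ((F.map f).hom s.1)
    simp

/-- The discretisation functor, `(disc F)(U) = disc F(U)`. -/
def disc : ((OrbitCat G B)ᵒᵖ ⥤ ModuleCat.{u} R) ⥤ GPresheaf G R B where
  obj F := ⟨discFunctorObj F, by
    rintro U ⟨s, H, hH, hs⟩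
    exact ⟨H, hH, fun h hh => Subtype.ext (hs h hh)⟩⟩
  map {F F'} φ := ObjectProperty.homMk
    { app := fun U => ModuleCat.ofHom
        ((φ.app U).hom.restrict fun _ hs => hom_mem_discPart (U := U.unop) φ hs)
      naturality := fun U V f => by
        ext s
        apply Subtype.ext
        exact congrArg (fun k => k.hom s.1) (φ.naturality f) }
  map_id F := rfl
  map_comp φ ψ := rfl

/-- The inclusion `disc F ⟶ F`. -/
def discι (F : (OrbitCat G B)ᵒᵖ ⥤ ModuleCat.{u} R) : (disc.obj F).obj ⟶ F where
  app U := ModuleCat.ofHom (discPart F U.unop).subtype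
  naturality _ _ _ := rfl

/-- The termwise product `U ↦ ∏ i, F i (U)` of functors `O_G(B)ᵒᵖ ⥤ R-mod`. -/
def termwiseProd (B : ClopenBasis X) (I : Type u) :
    (I → ((OrbitCat G B)ᵒᵖ ⥤ ModuleCat.{u} R)) ⥤ ((OrbitCat G B)ᵒᵖ ⥤ ModuleCat.{u} R) where
  obj F :=
    { obj := fun U => ModuleCat.of R (∀ i, (F i).obj U)
      map := fun f => ModuleCat.ofHom
        (LinearMap.pi fun i => ((F i).map f).hom.comp (LinearMap.proj i))
      map_id := fun U => by
        ext s i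
        exact congrArg (fun k => k.hom (s i)) ((F i).map_id U)
      map_comp := fun f g => by
        ext s i
        exact congrArg (fun k => k.hom (s i)) ((F i).map_comp f g) }
  map φ :=
    { app := fun U => ModuleCat.ofHom
        (LinearMap.pi fun i => ((φ i).app U).hom.comp (LinearMap.proj i))
      naturality := fun U V f => by
        ext s i
        exact congrArg (fun k => k.hom (s i)) ((φ i).naturality f) }
  map_id _ := rfl
  map_comp _ _ := rfl

/-- The presheaf product `U ↦ disc (∏ i, F i (U))`, as a functor of the family `F`. -/
def presheafProd (B : ClopenBasis X) (I : Type u) :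
    (I → GPresheaf G R B) ⥤ GPresheaf G R B :=
  Functor.pi (fun _ => (IsDiscretePresheaf G R B).ι) ⋙ termwiseProd B I ⋙ disc

/-- The projection from the presheaf product to its `i`-th factor. -/
def presheafProdProj (B : ClopenBasis X) {I : Type u} (F : I → GPresheaf G R B) (i : I) :
    (presheafProd B I).obj F ⟶ F i :=
  ObjectProperty.homMk (discι _ ≫
    { app := fun _ => ModuleCat.ofHom (LinearMap.proj i)
      naturality := fun _ _ _ => rfl })

end Disc

/-! ## The forgetful functor from sheaves to presheaves -/

section Forget

namespace GSheaf

/-- For `g V ⊆ U`, the map `Γ(U, E) → Γ(V, E)` sending `s` to `v ↦ g⁻¹ s(g v)`; for `g = 1` this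
is restriction of sections, and in general it is the restriction to `V` of `g⁻¹ ∗ s`. -/
def sectionsMap (A : GSheaf G X R) [ContinuousSMul G X] {U V : Set X} (g : G)
    (h : g • V ⊆ U) : A.sections U →ₗ[R] A.sections V where
  toFun s := ⟨fun v => ⟨g⁻¹ • (s.1 ⟨g • v.1, h (Set.smul_mem_smul_set v.2)⟩).1, by
      rw [A.p_smul, (s.1 _).2, inv_smul_smul]⟩, by
    have h1 : Continuous fun v : V => (⟨g • v.1, h (Set.smul_mem_smul_set v.2)⟩ : U) := by
      fun_prop
    exact (s.2.comp h1).const_smul g⁻¹⟩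
  map_add' s t := by
    apply Subtype.ext
    funext v
    apply Subtype.ext
    exact (congrArg Subtype.val ((A.isLinearMap_smul g⁻¹ (g • v.1)).map_add
      (s.1 ⟨g • v.1, h (Set.smul_mem_smul_set v.2)⟩)
      (t.1 ⟨g • v.1, h (Set.smul_mem_smul_set v.2)⟩))).trans
      (A.fibre_add_congr (inv_smul_smul g v.1) _ _ _ _ rfl rfl)
  map_smul' r s := by
    apply Subtype.ext
    funext v
    apply Subtype.ext
    exact (congrArg Subtype.val ((A.isLinearMap_smul g⁻¹ (g • v.1)).map_smul r
      (s.1 ⟨g • v.1, h (Set.smul_mem_smul_set v.2)⟩))).trans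
      (A.fibre_smul_congr (inv_smul_smul g v.1) _ _ _ rfl)

theorem sections_ext (A : GSheaf G X R) {U : Set X} {s t : A.sections U}
    (h : ∀ u, (s.1 u).1 = (t.1 u).1) : s = t :=
  Subtype.ext (funext fun u => Subtype.ext (h u))

variable [ContinuousSMul G X] {B : ClopenBasis X}

/-- The functor `U ↦ Γ(U, E)` on `O_G(B)ᵒᵖ`. -/
def sectionsFunctor (B : ClopenBasis X) (A : GSheaf G X R) :
    (OrbitCat G B)ᵒᵖ ⥤ ModuleCat.{u} R where
  obj U := ModuleCat.of R (A.sections U.unop.set)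
  map f := ModuleCat.ofHom (A.sectionsMap f.unop.1 f.unop.2)
  map_id U := by
    refine ModuleCat.hom_ext (LinearMap.ext fun s => A.sections_ext fun v => ?_)
    change (1 : G)⁻¹ • (s.1 ⟨(1 : G) • v.1, _⟩).1 = (s.1 v).1
    rw [inv_one, one_smul]
    exact A.section_congr s (Subtype.ext (one_smul G v.1))
  map_comp f g := by
    refine ModuleCat.hom_ext (LinearMap.ext fun s => A.sections_ext fun v => ?_)
    change (f.unop.1 * g.unop.1)⁻¹ • (s.1 ⟨(f.unop.1 * g.unop.1) • v.1, _⟩).1 =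
      g.unop.1⁻¹ • f.unop.1⁻¹ • (s.1 ⟨f.unop.1 • g.unop.1 • v.1, _⟩).1
    rw [mul_inv_rev, mul_smul]
    congr 2
    exact A.section_congr s (Subtype.ext (mul_smul _ _ v.1))

/-- Sections over an open set are open maps. -/
theorem isOpen_range_section (A : GSheaf G X R) {U : Set X} (hU : IsOpen U)
    (s : A.sections U) : IsOpen (Set.range fun u => (s.1 u).1) := by
  have h : IsOpenEmbedding (A.p ∘ fun u => (s.1 u).1) := by
    have : (A.p ∘ fun u => (s.1 u).1) = ((↑) : U → X) := funext fun u => (s.1 u).2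
    rw [this]; exact hU.isOpenEmbedding_subtypeVal
  have h2 : IsLocalHomeomorph (A.p ∘ fun u => (s.1 u).1) := h.isLocalHomeomorph
  exact (h2.of_comp A.isLocalHomeomorph s.2).isOpenMap.isOpen_range

theorem sectionsFunctor_isDiscrete [IsTopologicalGroup G] [CompactSpace X]
    (B : ClopenBasis X) (A : GSheaf G X R) :
    IsDiscretePresheaf G R B (A.sectionsFunctor B) := by
  intro U (s : A.sections U.set)
  have hc : CompactSpace U.set :=
    isCompact_iff_compactSpace.1 (B.isClopen _ U.mem).isClosed.isCompact
  refine ⟨fixingSubgroupOf (A.sectionsFunctor B) U s, ?_, fun h hh => hh⟩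
  refine Subgroup.isOpen_of_mem_nhds _ (g := 1) ?_
  have hmem : ∀ (g : MulAction.stabilizer G U.set) (u : U.set), g.1 • u.1 ∈ U.set := fun g u =>
    (MulAction.mem_stabilizer_iff.1 g.2).subset (Set.smul_mem_smul_set u.2)
  let m : MulAction.stabilizer G U.set × U.set → A.E := fun q =>
    q.1.1⁻¹ • (s.1 ⟨q.1.1 • q.2.1, hmem q.1 q.2⟩).1
  have hm : Continuous m := by
    have h1 : Continuous fun q : MulAction.stabilizer G U.set × U.set =>
        (⟨q.1.1 • q.2.1, hmem q.1 q.2⟩ : U.set) := by fun_prop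
    have h2 := s.2.comp h1
    have h3 : Continuous fun q : MulAction.stabilizer G U.set × U.set => q.1.1⁻¹ := by fun_prop
    exact h3.smul h2
  have ev : ∀ᶠ g : MulAction.stabilizer G U.set in 𝓝 1, ∀ u ∈ (Set.univ : Set U.set),
      m (g, u) ∈ Set.range fun u => (s.1 u).1 := by
    refine isCompact_univ.eventually_forall_of_forall_eventually fun u _ => ?_
    refine (hm.continuousAt (x := (1, u))).eventually ((A.isOpen_range_section U.isOpen s).mem_nhds ?_)
    refine ⟨u, ?_⟩
    change _ = (1 : G)⁻¹ • (s.1 ⟨(1 : G) • u.1, _⟩).1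
    rw [inv_one, one_smul]
    exact A.section_congr s (Subtype.ext (one_smul G u.1).symm)
  filter_upwards [ev] with g hg
  refine A.sections_ext fun v => ?_
  obtain ⟨w, hw⟩ := hg v trivial
  change m (g, v) = _
  have hp : A.p (m (g, v)) = v.1 := by
    change A.p (g.1⁻¹ • _) = _
    rw [A.p_smul, (s.1 _).2, inv_smul_smul]
  rw [← hw] at hp ⊢
  exact A.section_congr s (Subtype.ext ((s.1 w).2.symm.trans hp))

end GSheaf

/-- Applying a map of `G`-sheaves to sections. -/
def GSheaf.Hom.mapSections {A A' : GSheaf G X R} (f : GSheaf.Hom A A') (U : Set X) :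
    A.sections U →ₗ[R] A'.sections U where
  toFun s := ⟨fun u => f.fibreMap u.1 (s.1 u), f.continuous_toFun.comp s.2⟩
  map_add' _ _ := Subtype.ext (funext fun u => LinearMap.map_add (f.fibreMap u.1) _ _)
  map_smul' r _ := Subtype.ext (funext fun u => LinearMap.map_smul (f.fibreMap u.1) r _)

/-- The forgetful functor from `G`-sheaves to `G`-presheaves over `B`, `E ↦ (U ↦ Γ(U, E))`. -/
def forgetToPresheaf [IsTopologicalGroup G] [ContinuousSMul G X] [CompactSpace X]
    (B : ClopenBasis X) : GSheaf G X R ⥤ GPresheaf G R B where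
  obj A := ⟨A.sectionsFunctor B, A.sectionsFunctor_isDiscrete B⟩
  map {A A'} f := ObjectProperty.homMk
    { app := fun U => ModuleCat.ofHom (f.mapSections U.unop.set)
      naturality := fun U V k => by
        ext s
        exact A'.sections_ext fun v => f.map_smul _ _ }
  map_id _ := rfl
  map_comp _ _ := rfl

end Forget

/-! ## Equivariant sheafification -/

section Sheafify

namespace GPresheaf

variable {B : ClopenBasis X} (P : GPresheaf G R B)

/-- The `R`-module `P(U)`. -/
abbrev sec (U : OrbitCat G B) : Type u := P.obj.obj (op U)

/-- The map `P(U) → P(V)` induced by `g : G` with `g V ⊆ U`. -/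
def act {U V : OrbitCat G B} (g : G) (h : g • V.set ⊆ U.set) : P.sec U →ₗ[R] P.sec V :=
  (P.obj.map (OrbitCat.homMk g h).op).hom

/-- The restriction map `P(U) → P(V)`. -/
def res {U V : OrbitCat G B} (h : V.set ⊆ U.set) : P.sec U →ₗ[R] P.sec V :=
  P.act 1 ((one_smul G V.set).subset.trans h)

theorem act_act {U V W : OrbitCat G B} (g k : G) (h : g • V.set ⊆ U.set)
    (h' : k • W.set ⊆ V.set) (s : P.sec U) :
    P.act k h' (P.act g h s) = P.act (g * k)
      ((mul_smul g k W.set).subset.trans ((Set.smul_set_mono h').trans h)) s := by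
  have e := congrArg (fun k => k.hom s) (P.obj.map_comp
    (OrbitCat.homMk g h).op (OrbitCat.homMk k h').op)
  simp only [ModuleCat.hom_comp, LinearMap.comp_apply] at e
  exact e.symm

theorem act_congr {U V : OrbitCat G B} {g k : G} (e : g = k) (h : g • V.set ⊆ U.set)
    (s : P.sec U) : P.act g h s = P.act k (e ▸ h) s := by
  subst e; rfl

theorem res_self {U : OrbitCat G B} (s : P.sec U) : P.res (subset_refl U.set) s = s :=
  congrArg (fun k => k.hom s) (P.obj.map_id (op U))

theorem res_res {U V W : OrbitCat G B} (h : V.set ⊆ U.set) (h' : W.set ⊆ V.set) (s : P.sec U) :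
    P.res h' (P.res h s) = P.res (h'.trans h) s :=
  (P.act_act ..).trans (P.act_congr (mul_one 1) _ _)

theorem res_act {U V W : OrbitCat G B} (g : G) (h : g • V.set ⊆ U.set) (h' : W.set ⊆ V.set)
    (s : P.sec U) : P.res h' (P.act g h s) = P.act g ((Set.smul_set_mono h').trans h) s :=
  (P.act_act ..).trans (P.act_congr (mul_one g) _ _)

theorem act_res {U V W : OrbitCat G B} (g : G) (h : V.set ⊆ U.set) (h' : g • W.set ⊆ V.set)
    (s : P.sec U) : P.act g h' (P.res h s) = P.act g (h'.trans h) s :=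
  (P.act_act ..).trans (P.act_congr (one_mul g) _ _)

/-- The members of the basis which contain `x`, ordered by reverse inclusion. -/
structure Nhd (G : Type u) {X : Type u} [TopologicalSpace X] (B : ClopenBasis X) (x : X) where
  set : OrbitCat G B
  mem : x ∈ set.set

instance (x : X) : Preorder (Nhd G B x) where
  le U V := V.set.set ⊆ U.set.set
  le_refl _ := subset_rfl
  le_trans _ _ _ h h' := h'.trans h

theorem _root_.OrbitCat.exists_subset (G : Type u) (B : ClopenBasis X) {x : X} {O : Set X}
    (hO : IsOpen O) (hx : x ∈ O) : ∃ W : OrbitCat G B, x ∈ W.set ∧ W.set ⊆ O := by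
  obtain ⟨W, hW, hx, h⟩ := B.isBasis.exists_subset_of_mem_open hx hO
  exact ⟨⟨W, hW⟩, hx, h⟩

instance (x : X) : IsDirectedOrder (Nhd G B x) where
  directed U V := by
    obtain ⟨W, hx, h⟩ := OrbitCat.exists_subset G B (U.set.isOpen.inter V.set.isOpen)
      ⟨U.mem, V.mem⟩
    exact ⟨⟨W, hx⟩, h.trans Set.inter_subset_left, h.trans Set.inter_subset_right⟩

instance (x : X) : Nonempty (Nhd G B x) := by
  obtain ⟨W, hx, -⟩ := OrbitCat.exists_subset G B isOpen_univ (Set.mem_univ x)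
  exact ⟨⟨W, hx⟩⟩

/-- The restriction maps between the values of `P` on neighbourhoods of `x`. -/
abbrev nhdRes (x : X) : ∀ U V : Nhd G B x, U ≤ V → P.sec U.set →ₗ[R] P.sec V.set :=
  fun _ _ h => P.res h

instance (x : X) : DirectedSystem (fun U : Nhd G B x => P.sec U.set) (P.nhdRes x · · ·) where
  map_self _ s := P.res_self s
  map_map _ _ _ h h' s := P.res_res h h' s

/-- The stalk `P_x = colim_{x ∈ U ∈ B} P(U)`. -/
def Germ (x : X) : Type u := DirectLimit (fun U : Nhd G B x => P.sec U.set) (P.nhdRes x)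

instance (x : X) : AddCommGroup (P.Germ x) :=
  inferInstanceAs (AddCommGroup (DirectLimit (fun U : Nhd G B x => P.sec U.set) (P.nhdRes x)))

instance (x : X) : Module R (P.Germ x) :=
  inferInstanceAs (Module R (DirectLimit (fun U : Nhd G B x => P.sec U.set) (P.nhdRes x)))

/-- The germ at `x` of an element of `P(U)`. -/
def germ (U : OrbitCat G B) (x : X) (hx : x ∈ U.set) : P.sec U →ₗ[R] P.Germ x :=
  DirectLimit.Module.of R (Nhd G B x) (fun U : Nhd G B x => P.sec U.set) (P.nhdRes x) ⟨U, hx⟩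

variable {P} in
/-- Linear maps out of a stalk. -/
def germLift {x : X} {M : Type u} [AddCommGroup M] [Module R M]
    (f : ∀ U : OrbitCat G B, x ∈ U.set → P.sec U →ₗ[R] M)
    (hf : ∀ (U V : OrbitCat G B) (hU : x ∈ U.set) (hV : x ∈ V.set) (h : V.set ⊆ U.set)
      (s : P.sec U), f V hV (P.res h s) = f U hU s) : P.Germ x →ₗ[R] M :=
  DirectLimit.Module.lift R (Nhd G B x) (fun U : Nhd G B x => P.sec U.set) (P.nhdRes x)
    (fun U => f U.set U.mem) (fun U V h s => hf U.set V.set U.mem V.mem h s)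

theorem germLift_germ {x : X} {M : Type u} [AddCommGroup M] [Module R M]
    (f : ∀ U : OrbitCat G B, x ∈ U.set → P.sec U →ₗ[R] M) (hf) (U : OrbitCat G B)
    (hx : x ∈ U.set) (s : P.sec U) : germLift f hf (P.germ U x hx s) = f U hx s := rfl

theorem germ_eq_iff {x : X} {U V : OrbitCat G B} (hU : x ∈ U.set) (hV : x ∈ V.set)
    (s : P.sec U) (t : P.sec V) : P.germ U x hU s = P.germ V x hV t ↔
      ∃ (W : OrbitCat G B) (hWU : W.set ⊆ U.set) (hWV : W.set ⊆ V.set), x ∈ W.set ∧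
        P.res hWU s = P.res hWV t := by
  constructor
  · intro h
    obtain ⟨W, h1, h2, h3⟩ := Quotient.exact h
    exact ⟨W.set, h1, h2, W.mem, h3⟩
  · rintro ⟨W, h1, h2, hx, h3⟩
    exact Quotient.sound ⟨⟨W, hx⟩, h1, h2, h3⟩

theorem germ_res {x : X} {U V : OrbitCat G B} (h : V.set ⊆ U.set) (hx : x ∈ V.set)
    (s : P.sec U) : P.germ V x hx (P.res h s) = P.germ U x (h hx) s :=
  (P.germ_eq_iff ..).2 ⟨V, subset_rfl, h, hx, P.res_self _⟩

theorem exists_germ {x : X} (a : P.Germ x) :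
    ∃ (U : OrbitCat G B) (hx : x ∈ U.set) (s : P.sec U), a = P.germ U x hx s := by
  induction a using Quotient.inductionOn with
  | _ a => exact ⟨a.1.set, a.1.mem, a.2, rfl⟩

variable [ContinuousSMul G X]

theorem exists_translate (g : G) {x : X} (U : OrbitCat G B) (hx : x ∈ U.set) :
    ∃ W : OrbitCat G B, g • x ∈ W.set ∧ g⁻¹ • W.set ⊆ U.set := by
  obtain ⟨W, h1, h2⟩ := OrbitCat.exists_subset G B (U.isOpen.smul g)
    (Set.smul_mem_smul_set hx)
  exact ⟨W, h1, by rw [← inv_smul_smul g U.set]; exact Set.smul_set_mono h2⟩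

theorem germ_act_eq (g : G) {x : X} {U V W W' : OrbitCat G B} (hW : g • x ∈ W.set)
    (hW' : g • x ∈ W'.set) (hWU : g⁻¹ • W.set ⊆ U.set) (hWV : g⁻¹ • W'.set ⊆ V.set)
    (h : V.set ⊆ U.set) (s : P.sec U) :
    P.germ W' (g • x) hW' (P.act g⁻¹ hWV (P.res h s)) =
      P.germ W (g • x) hW (P.act g⁻¹ hWU s) := by
  obtain ⟨W'', hx, h'⟩ := OrbitCat.exists_subset G B (W.isOpen.inter W'.isOpen) ⟨hW, hW'⟩
  refine (P.germ_eq_iff ..).2 ⟨W'', h'.trans Set.inter_subset_right,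
    h'.trans Set.inter_subset_left, hx, ?_⟩
  rw [act_res, res_act, res_act]

/-- The map `g : P_x → P_{g x}`, sending the germ of `s` at `x` to the germ of `g ∗ s` at `g x`
(restricted to a member of the basis inside `g U`). -/
def germAct (g : G) (x : X) : P.Germ x →ₗ[R] P.Germ (g • x) :=
  germLift (fun U hx => (P.germ (exists_translate g U hx).choose (g • x)
      (exists_translate g U hx).choose_spec.1).comp
      (P.act g⁻¹ (exists_translate g U hx).choose_spec.2))
    (fun _ _ _ _ h s => P.germ_act_eq g _ _ _ _ h s)

theorem germAct_germ (g : G) {x : X} {U W : OrbitCat G B} (hx : x ∈ U.set)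
    (hW : g • x ∈ W.set) (h : g⁻¹ • W.set ⊆ U.set) (s : P.sec U) :
    P.germAct g x (P.germ U x hx s) = P.germ W (g • x) hW (P.act g⁻¹ h s) := by
  have := P.germ_act_eq g (exists_translate g U hx).choose_spec.1 hW
    (exists_translate g U hx).choose_spec.2 h subset_rfl s
  rw [res_self] at this
  exact this.symm

/-- The total space `∐ x, P_x` of the sheaf space of `P`. -/
def Total : Type u := Σ x : X, P.Germ x

/-- The projection of the total space. -/
def proj (e : P.Total) : X := e.1

/-- The point `s_x` of the total space. -/
def pt (U : OrbitCat G B) (s : P.sec U) (x : U.set) : P.Total := ⟨x.1, P.germ U x.1 x.2 s⟩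

theorem exists_pt (e : P.Total) : ∃ (U : OrbitCat G B) (s : P.sec U) (x : U.set),
    e = P.pt U s x := by
  obtain ⟨x, a⟩ := e
  obtain ⟨U, hx, s, rfl⟩ := P.exists_germ a
  exact ⟨U, s, ⟨x, hx⟩, rfl⟩

theorem pt_eq_iff {U V : OrbitCat G B} {s : P.sec U} {t : P.sec V} {x : U.set} {y : V.set} :
    P.pt U s x = P.pt V t y ↔ x.1 = y.1 ∧ ∃ (W : OrbitCat G B) (hWU : W.set ⊆ U.set)
      (hWV : W.set ⊆ V.set), x.1 ∈ W.set ∧ P.res hWU s = P.res hWV t := by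
  obtain ⟨x, hx⟩ := x
  obtain ⟨y, hy⟩ := y
  constructor
  · intro h
    obtain rfl : x = y := congrArg Sigma.fst h
    exact ⟨rfl, (P.germ_eq_iff hx hy s t).1 (eq_of_heq (Sigma.mk.inj h).2)⟩
  · rintro ⟨h, h'⟩
    obtain rfl : x = y := h
    exact Sigma.ext rfl (heq_of_eq ((P.germ_eq_iff hx hy s t).2 h'))

theorem pt_res {U V : OrbitCat G B} (h : V.set ⊆ U.set) (s : P.sec U) (x : V.set) :
    P.pt V (P.res h s) x = P.pt U s ⟨x.1, h x.2⟩ :=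
  P.pt_eq_iff.2 ⟨rfl, V, subset_rfl, h, x.2, P.res_self _⟩

/-- The topology generated by the sets `B(s, U) = {s_x | x ∈ U}`, for `U ∈ B`, `s ∈ P(U)`. -/
instance : TopologicalSpace P.Total :=
  TopologicalSpace.generateFrom {S | ∃ (U : OrbitCat G B) (s : P.sec U), S = Set.range (P.pt U s)}

theorem isOpen_range_pt (U : OrbitCat G B) (s : P.sec U) : IsOpen (Set.range (P.pt U s)) :=
  isOpen_generateFrom_of_mem ⟨U, s, rfl⟩

theorem continuous_pt (U : OrbitCat G B) (s : P.sec U) : Continuous (P.pt U s) := by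
  refine continuous_generateFrom_iff.2 ?_
  rintro _ ⟨V, t, rfl⟩
  refine isOpen_iff_forall_mem_open.2 ?_
  rintro x ⟨y, hy⟩
  obtain ⟨e, W, h1, h2, hx, h3⟩ := P.pt_eq_iff.1 hy
  refine ⟨Subtype.val ⁻¹' W.set, ?_, W.isOpen.preimage continuous_subtype_val,
    show x.1 ∈ W.set from e ▸ hx⟩
  intro z hz
  refine ⟨⟨z.1, h1 hz⟩, ?_⟩
  have a := P.pt_res h1 t ⟨z.1, hz⟩
  have b := P.pt_res h2 s ⟨z.1, hz⟩
  rw [← a, h3, b]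

theorem isOpenMap_pt (U : OrbitCat G B) (s : P.sec U) : IsOpenMap (P.pt U s) := by
  intro O hO
  obtain ⟨O', hO', rfl⟩ := isOpen_induced_iff.1 hO
  refine isOpen_iff_forall_mem_open.2 ?_
  rintro _ ⟨x, hx, rfl⟩
  obtain ⟨W, hxW, hW⟩ := OrbitCat.exists_subset G B (U.isOpen.inter hO') ⟨x.2, hx⟩
  refine ⟨Set.range (P.pt W (P.res (hW.trans Set.inter_subset_left) s)), ?_,
    P.isOpen_range_pt _ _, ⟨⟨x.1, hxW⟩, P.pt_res _ _ _⟩⟩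
  rintro _ ⟨z, rfl⟩
  exact ⟨⟨z.1, (hW z.2).1⟩, (hW z.2).2, (P.pt_res _ _ _).symm⟩

theorem continuous_proj : Continuous P.proj := by
  refine continuous_def.2 fun O hO => isOpen_iff_forall_mem_open.2 fun e he => ?_
  obtain ⟨U, s, x, rfl⟩ := P.exists_pt e
  refine ⟨P.pt U s '' (Subtype.val ⁻¹' O), ?_,
    P.isOpenMap_pt U s _ (hO.preimage continuous_subtype_val), ⟨x, he, rfl⟩⟩
  rintro _ ⟨z, hz, rfl⟩
  exact hz

theorem isLocalHomeomorph_proj : IsLocalHomeomorph P.proj := by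
  rw [isLocalHomeomorph_iff_isOpenEmbedding_restrict]
  intro e
  obtain ⟨U, s, x, rfl⟩ := P.exists_pt e
  refine ⟨Set.range (P.pt U s), (P.isOpen_range_pt U s).mem_nhds ⟨x, rfl⟩, ?_⟩
  refine isOpenEmbedding_iff_continuous_injective_isOpenMap.2 ⟨?_, ?_, ?_⟩
  · exact P.continuous_proj.comp continuous_subtype_val
  · rintro ⟨_, y, rfl⟩ ⟨_, z, rfl⟩ h
    obtain rfl : y = z := Subtype.ext h
    rfl
  · intro O hO
    have h : (Set.range (P.pt U s)).domRestrict P.proj '' O =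
        Subtype.val '' (P.pt U s ⁻¹' (Subtype.val '' O)) := by
      ext z
      constructor
      · rintro ⟨⟨_, y, rfl⟩, hy, rfl⟩
        exact ⟨y, ⟨_, hy, rfl⟩, rfl⟩
      · rintro ⟨y, ⟨w, hw, hwy⟩, rfl⟩
        exact ⟨w, hw, congrArg P.proj hwy⟩
    rw [h]
    exact U.isOpen.isOpenMap_subtype_val _
      (((P.isOpen_range_pt U s).isOpenMap_subtype_val _ hO).preimage (P.continuous_pt U s))

instance : SMul G P.Total where
  smul g e := ⟨g • e.1, P.germAct g e.1 e.2⟩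

theorem smul_pt (g : G) {U W : OrbitCat G B} (s : P.sec U) (x : U.set)
    (hW : g • x.1 ∈ W.set) (h : g⁻¹ • W.set ⊆ U.set) :
    g • P.pt U s x = P.pt W (P.act g⁻¹ h s) ⟨g • x.1, hW⟩ :=
  Sigma.ext rfl (heq_of_eq (P.germAct_germ g x.2 hW h s))

instance : MulAction G P.Total where
  one_smul e := by
    obtain ⟨U, s, x, rfl⟩ := P.exists_pt e
    have hx : (1 : G) • x.1 = x.1 := one_smul _ _
    have hxU : (1 : G) • x.1 ∈ U.set := by rw [hx]; exact x.2
    have hU : (1 : G)⁻¹ • U.set = U.set := by rw [inv_one, one_smul]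
    rw [P.smul_pt 1 s x (W := U) hxU hU.subset]
    refine P.pt_eq_iff.2 ⟨hx, U, subset_rfl, subset_rfl, hxU, ?_⟩
    rw [res_act]
    exact P.act_congr inv_one _ _
  mul_smul g k e := by
    obtain ⟨U, s, x, rfl⟩ := P.exists_pt e
    obtain ⟨V, hV, hVU⟩ := exists_translate k U x.2
    obtain ⟨W, hW, hWV⟩ := exists_translate g V hV
    have hW' : (g * k) • x.1 ∈ W.set := by rw [mul_smul]; exact hW
    rw [P.smul_pt k s x hV hVU, P.smul_pt g _ _ hW hWV,
      P.smul_pt (g * k) s x (W := W) hW'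
        (by rw [mul_inv_rev, mul_smul]; exact (Set.smul_set_mono hWV).trans hVU)]
    refine P.pt_eq_iff.2 ⟨mul_smul _ _ _, W, subset_rfl, subset_rfl,
      hW', ?_⟩
    rw [res_act, res_act, act_act]
    exact P.act_congr (mul_inv_rev _ _) _ _

instance [IsTopologicalGroup G] [CompactSpace X] : ContinuousSMul G P.Total where
  continuous_smul := by
    refine continuous_generateFrom_iff.2 ?_
    rintro _ ⟨U, s, rfl⟩
    refine isOpen_iff_mem_nhds.2 ?_
    rintro ⟨g, e⟩ ⟨u, hu⟩
    obtain ⟨W, t, y, rfl⟩ := P.exists_pt e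
    obtain ⟨W', hW', hW'W⟩ := exists_translate g W y.2
    change P.pt U s u = g • P.pt W t y at hu
    rw [P.smul_pt g t y hW' hW'W] at hu
    obtain ⟨hux, V, hVU, hVW', huV, hV⟩ := P.pt_eq_iff.1 hu
    obtain ⟨H, hH, hHs⟩ := P.property V (P.res hVU s)
    have hH' : IsOpen ((H.map (Subgroup.subtype _) : Subgroup G) : Set G) :=
      V.isOpen_stabilizer.isOpenMap_subtype_val _ hH
    have n1 : {a : G | a * g⁻¹ ∈ (H.map (Subgroup.subtype _) : Subgroup G)} ∈ 𝓝 g := by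
      refine (hH'.preimage (continuous_mul_const g⁻¹)).mem_nhds ?_
      simp only [Set.mem_preimage, mul_inv_cancel]
      exact one_mem _
    have n2 : P.pt W t '' (Subtype.val ⁻¹' (g⁻¹ • V.set)) ∈ 𝓝 (P.pt W t y) := by
      refine (P.isOpenMap_pt W t _
        ((V.isOpen.smul g⁻¹).preimage continuous_subtype_val)).mem_nhds ⟨y, ?_, rfl⟩
      refine Set.mem_preimage.2 (Set.mem_inv_smul_set_iff.2 ?_)
      rw [hux] at huV
      exact huV
    rw [nhds_prod_eq]
    refine Filter.mem_of_superset (Filter.prod_mem_prod n1 n2) ?_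
    rintro ⟨a, _⟩ ⟨⟨n, hn, hna⟩, z, hz, rfl⟩
    have hna' : n.1 = a * g⁻¹ := hna
    obtain rfl : a = n.1 * g := by rw [hna']; group
    have hnV : n.1⁻¹ • V.set = V.set := MulAction.mem_stabilizer_iff.1 (inv_mem n.2)
    have hzV : (n.1 * g) • z.1 ∈ V.set := by
      rw [mul_smul]
      exact (MulAction.mem_stabilizer_iff.1 n.2).subset
        (Set.smul_mem_smul_set (Set.mem_inv_smul_set_iff.1 hz))
    have hVW : g⁻¹ • V.set ⊆ W.set := (Set.smul_set_mono hVW').trans hW'W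
    have hVW2 : (n.1 * g)⁻¹ • V.set ⊆ W.set := by
      rw [mul_inv_rev, mul_smul, hnV]; exact hVW
    refine ⟨⟨(n.1 * g) • z.1, hVU hzV⟩, ?_⟩
    change _ = (n.1 * g) • P.pt W t z
    rw [P.smul_pt _ t z hzV hVW2, ← P.pt_res hVU s ⟨_, hzV⟩]
    congr 1
    have h1 := hHs n⁻¹ (inv_mem hn)
    change P.act n.1⁻¹ hnV.subset (P.res hVU s) = _ at h1
    rw [← h1, hV, res_act, act_act]
    exact P.act_congr (mul_inv_rev _ _).symm _ _

/-- The fibre of the total space over `x` is the stalk. -/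
def fibreEquiv (x : X) : {e : P.Total // P.proj e = x} ≃ P.Germ x := Equiv.sigmaSubtype x

instance (x : X) : AddCommGroup {e : P.Total // P.proj e = x} := (P.fibreEquiv x).addCommGroup

instance (x : X) : Module R {e : P.Total // P.proj e = x} := (P.fibreEquiv x).module R

/-- The point `s_x` as an element of the fibre over `x`. -/
def ptFibre (U : OrbitCat G B) (s : P.sec U) {x : X} (hx : x ∈ U.set) :
    {e : P.Total // P.proj e = x} :=
  ⟨P.pt U s ⟨x, hx⟩, rfl⟩

theorem ptFibre_add {U : OrbitCat G B} (s t : P.sec U) {x : X} (hx : x ∈ U.set) :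
    P.ptFibre U s hx + P.ptFibre U t hx = P.ptFibre U (s + t) hx :=
  Subtype.ext (congrArg (Sigma.mk x) (map_add (P.germ U x hx) s t).symm)

theorem ptFibre_sub {U : OrbitCat G B} (s t : P.sec U) {x : X} (hx : x ∈ U.set) :
    P.ptFibre U s hx - P.ptFibre U t hx = P.ptFibre U (s - t) hx :=
  Subtype.ext (congrArg (Sigma.mk x) (map_sub (P.germ U x hx) s t).symm)

theorem ptFibre_smul {U : OrbitCat G B} (r : R) (s : P.sec U) {x : X} (hx : x ∈ U.set) :
    r • P.ptFibre U s hx = P.ptFibre U (r • s) hx :=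
  Subtype.ext (congrArg (Sigma.mk x) (map_smul (P.germ U x hx) r s).symm)

theorem smul_ptFibre (g : G) {U W : OrbitCat G B} (s : P.sec U) {x : X} (hx : x ∈ U.set)
    (hW : g • x ∈ W.set) (h : g⁻¹ • W.set ⊆ U.set) (h') :
    (⟨g • (P.ptFibre U s hx).1, h'⟩ : {e : P.Total // P.proj e = g • x}) =
      P.ptFibre W (P.act g⁻¹ h s) hW :=
  Subtype.ext (P.smul_pt g s ⟨x, hx⟩ hW h)

theorem exists_ptFibre {x : X} (a b : {e : P.Total // P.proj e = x}) :
    ∃ (U : OrbitCat G B) (s t : P.sec U) (hx : x ∈ U.set),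
      a = P.ptFibre U s hx ∧ b = P.ptFibre U t hx := by
  obtain ⟨a, rfl⟩ := a
  obtain ⟨b, hb⟩ := b
  obtain ⟨U, s, y, rfl⟩ := P.exists_pt a
  obtain ⟨V, t, z, rfl⟩ := P.exists_pt b
  have hb' : z.1 = y.1 := hb
  obtain ⟨W, hyW, hW⟩ := OrbitCat.exists_subset G B (U.isOpen.inter V.isOpen)
    ⟨y.2, by rw [← hb']; exact z.2⟩
  refine ⟨W, P.res (hW.trans Set.inter_subset_left) s, P.res (hW.trans Set.inter_subset_right) t,
    hyW, Subtype.ext ?_, Subtype.ext ?_⟩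
  · exact (P.pt_res (hW.trans Set.inter_subset_left) s ⟨y.1, hyW⟩).symm
  · refine Eq.trans ?_ (P.pt_res (hW.trans Set.inter_subset_right) t ⟨y.1, hyW⟩).symm
    exact congrArg (P.pt V t) (Subtype.ext hb')

/-- The `G`-sheaf given by the sheaf space of a `G`-presheaf. -/
def sheafify [IsTopologicalGroup G] [CompactSpace X] : GSheaf G X R where
  E := P.Total
  p := P.proj
  isLocalHomeomorph := P.isLocalHomeomorph_proj
  p_smul _ _ := rfl
  continuous_fibreSub := by
    refine continuous_generateFrom_iff.2 ?_
    rintro _ ⟨V, r, rfl⟩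
    refine isOpen_iff_mem_nhds.2 ?_
    rintro ⟨⟨a, b⟩, hab⟩ ⟨v, hv⟩
    obtain ⟨x, hxa⟩ : ∃ x, P.proj a = x := ⟨_, rfl⟩
    obtain ⟨U, s, t, hx, ha, hb⟩ := P.exists_ptFibre ⟨a, hxa⟩ ⟨b, hab.trans hxa⟩
    obtain rfl : a = P.pt U s ⟨x, hx⟩ := congrArg Subtype.val ha
    obtain rfl : b = P.pt U t ⟨x, hx⟩ := congrArg Subtype.val hb
    have hv' : P.pt V r v = P.pt U (s - t) ⟨_, hx⟩ :=
      hv.trans (congrArg Subtype.val (P.ptFibre_sub s t hx))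
    obtain ⟨hvx, W, hWV, hWU, hvW, hW⟩ := P.pt_eq_iff.1 hv'
    have n1 : IsOpen (Set.range (P.pt W (P.res hWU s)) ×ˢ Set.range (P.pt W (P.res hWU t))) :=
      (P.isOpen_range_pt _ _).prod (P.isOpen_range_pt _ _)
    refine Filter.mem_of_superset
      ((n1.preimage continuous_subtype_val).mem_nhds ⟨⟨⟨_, hvW⟩, ?_⟩, ⟨⟨_, hvW⟩, ?_⟩⟩) ?_
    · rw [P.pt_res]; exact congrArg (P.pt U s) (Subtype.ext hvx)
    · rw [P.pt_res]; exact congrArg (P.pt U t) (Subtype.ext hvx)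
    · rintro ⟨⟨_, _⟩, h⟩ ⟨⟨y, rfl⟩, ⟨z, rfl⟩⟩
      obtain rfl : z = y := Subtype.ext h
      refine ⟨⟨z.1, hWV z.2⟩, ?_⟩
      refine Eq.trans ?_ (congrArg Subtype.val
        (P.ptFibre_sub (P.res hWU s) (P.res hWU t) z.2)).symm
      change _ = P.pt W _ z
      rw [← map_sub, ← hW, P.pt_res]
  continuous_fibreSMul r := by
    refine continuous_generateFrom_iff.2 ?_
    rintro _ ⟨V, q, rfl⟩
    refine isOpen_iff_mem_nhds.2 ?_
    rintro a ⟨v, hv⟩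
    obtain ⟨U, s, x, rfl⟩ := P.exists_pt a
    have hv' : P.pt V q v = P.pt U (r • s) x := 
      hv.trans (congrArg Subtype.val (P.ptFibre_smul r s x.2))
    obtain ⟨hvx, W, hWV, hWU, hvW, hW⟩ := P.pt_eq_iff.1 hv'
    refine Filter.mem_of_superset
      ((P.isOpen_range_pt W (P.res hWU s)).mem_nhds ⟨⟨_, hvW⟩, ?_⟩) ?_
    · rw [P.pt_res]; exact congrArg (P.pt U s) (Subtype.ext hvx)
    · rintro _ ⟨z, rfl⟩
      refine ⟨⟨z.1, hWV z.2⟩, ?_⟩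
      refine Eq.trans ?_ (congrArg Subtype.val
        (P.ptFibre_smul r (P.res hWU s) z.2)).symm
      change _ = P.pt W _ z
      rw [← map_smul, ← hW, P.pt_res]
  isLinearMap_smul g x := by
    constructor
    · intro a b
      obtain ⟨U, s, t, hx, rfl, rfl⟩ := P.exists_ptFibre a b
      obtain ⟨W, hW, hWU⟩ := exists_translate g U hx
      refine Eq.trans ?_ ((congrArg₂ (· + ·) (P.smul_ptFibre g s hx hW hWU rfl)
        (P.smul_ptFibre g t hx hW hWU rfl)).trans (P.ptFibre_add _ _ hW)).symm
      rw [← map_add, ← P.smul_ptFibre g (s + t) hx hW hWU rfl]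
      exact Subtype.ext (congrArg (g • ·) (congrArg Subtype.val (P.ptFibre_add s t hx)))
    · intro r a
      obtain ⟨U, s, t, hx, rfl, -⟩ := P.exists_ptFibre a a
      obtain ⟨W, hW, hWU⟩ := exists_translate g U hx
      refine Eq.trans ?_ ((congrArg (r • ·) (P.smul_ptFibre g s hx hW hWU rfl)).trans
        (P.ptFibre_smul _ _ hW)).symm
      rw [← map_smul, ← P.smul_ptFibre g (r • s) hx hW hWU rfl]
      exact Subtype.ext (congrArg (g • ·) (congrArg Subtype.val (P.ptFibre_smul r s hx)))

variable {P}

/-- The map induced on `P(U)` by a map of presheaves. -/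
def mapSec {Q : GPresheaf G R B} (φ : P ⟶ Q) (U : OrbitCat G B) : P.sec U →ₗ[R] Q.sec U :=
  (φ.hom.app (op U)).hom

theorem mapSec_act {Q : GPresheaf G R B} (φ : P ⟶ Q) {U V : OrbitCat G B} (g : G)
    (h : g • V.set ⊆ U.set) (s : P.sec U) :
    mapSec φ V (P.act g h s) = Q.act g h (mapSec φ U s) :=
  congrArg (fun k => k.hom s) (φ.hom.naturality (OrbitCat.homMk g h).op)

/-- The map induced on stalks by a map of presheaves. -/
def mapGerm {Q : GPresheaf G R B} (φ : P ⟶ Q) (x : X) : P.Germ x →ₗ[R] Q.Germ x :=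
  germLift (fun U hx => (Q.germ U x hx).comp (mapSec φ U))
    (fun U V _ hV h s => by
      change Q.germ V x hV (mapSec φ V (P.act 1 _ s)) = _
      rw [mapSec_act]
      exact Q.germ_res h hV _)

/-- The map induced on total spaces by a map of presheaves, `s_x ↦ (φ s)_x`. -/
def mapTotal {Q : GPresheaf G R B} (φ : P ⟶ Q) (e : P.Total) : Q.Total :=
  ⟨e.1, mapGerm φ e.1 e.2⟩

theorem mapTotal_pt {Q : GPresheaf G R B} (φ : P ⟶ Q) {U : OrbitCat G B} (s : P.sec U)
    (x : U.set) : mapTotal φ (P.pt U s x) = Q.pt U (mapSec φ U s) x := rfl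

/-- A function out of the total space is continuous if its composites with all
`x ↦ s_x` are. -/
theorem continuous_of_pt {T : Type u} [TopologicalSpace T] (f : P.Total → T)
    (h : ∀ (U : OrbitCat G B) (s : P.sec U), Continuous fun x => f (P.pt U s x)) :
    Continuous f := by
  refine continuous_def.2 fun O hO => isOpen_iff_forall_mem_open.2 fun e he => ?_
  obtain ⟨U, s, x, rfl⟩ := P.exists_pt e
  refine ⟨P.pt U s '' ((fun x => f (P.pt U s x)) ⁻¹' O), ?_,
    P.isOpenMap_pt U s _ (hO.preimage (h U s)), ⟨x, he, rfl⟩⟩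
  rintro _ ⟨z, hz, rfl⟩
  exact hz

end GPresheaf

variable [IsTopologicalGroup G] [ContinuousSMul G X] [CompactSpace X]

/-- The equivariant sheafification functor `ℓ`. -/
def eqSheafification (B : ClopenBasis X) : GPresheaf G R B ⥤ GSheaf G X R where
  obj P := P.sheafify
  map {P Q} φ :=
    { toFun := GPresheaf.mapTotal φ
      continuous_toFun := GPresheaf.continuous_of_pt _ fun U s => Q.continuous_pt U
        (GPresheaf.mapSec φ U s)
      p_toFun := fun _ => rfl
      map_smul := fun g e => by
        obtain ⟨U, s, x, rfl⟩ := P.exists_pt e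
        obtain ⟨W, hW, hWU⟩ := GPresheaf.exists_translate g U x.2
        have h1 := P.smul_pt g s x hW hWU
        have h2 := Q.smul_pt g (GPresheaf.mapSec φ U s) x hW hWU
        refine (congrArg (GPresheaf.mapTotal φ) h1).trans (Eq.trans ?_ h2.symm)
        rw [GPresheaf.mapTotal_pt, GPresheaf.mapSec_act]
      isLinearMap_fibre := fun x => by
        constructor
        · intro a b
          obtain ⟨U, s, t, hx, rfl, rfl⟩ := P.exists_ptFibre a b
          refine Eq.trans ?_ (Q.ptFibre_add (GPresheaf.mapSec φ U s)
            (GPresheaf.mapSec φ U t) hx).symm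
          rw [← map_add]
          exact Subtype.ext (congrArg (GPresheaf.mapTotal φ)
            (congrArg Subtype.val (P.ptFibre_add s t hx)))
        · intro r a
          obtain ⟨U, s, t, hx, rfl, -⟩ := P.exists_ptFibre a a
          refine Eq.trans ?_ (Q.ptFibre_smul r (GPresheaf.mapSec φ U s) hx).symm
          rw [← map_smul]
          exact Subtype.ext (congrArg (GPresheaf.mapTotal φ)
            (congrArg Subtype.val (P.ptFibre_smul r s hx))) }
  map_id P := GSheaf.hom_ext fun e => by
    obtain ⟨U, s, x, rfl⟩ := P.exists_pt e
    rfl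
  map_comp {P Q S} φ ψ := GSheaf.hom_ext fun e => by
    obtain ⟨U, s, x, rfl⟩ := P.exists_pt e
    rfl

/-- The evaluation of the sections of a `G`-sheaf on stalks, `s_x ↦ s(x)`. -/
def evalGerm (B : ClopenBasis X) (A : GSheaf G X R) (x : X) :
    ((forgetToPresheaf B).obj A).Germ x →ₗ[R] A.Fibre x :=
  GPresheaf.germLift
    (fun U hx => (LinearMap.proj (⟨x, hx⟩ : U.set)).comp (A.sections U.set).subtype)
    (fun U V hU hV h s => by
      apply Subtype.ext
      change (1 : G)⁻¹ • (s.1 ⟨(1 : G) • x, _⟩).1 = (s.1 ⟨x, hU⟩).1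
      rw [inv_one, one_smul]
      exact A.section_congr s (Subtype.ext (one_smul G x)))

/-- The canonical map `ℓ(forget A) ⟶ A` for a `G`-sheaf `A`: it sends the germ `s_x` of a
section `s ∈ Γ(U, A)` to `s(x)`. -/
def sheafificationCounit (B : ClopenBasis X) (A : GSheaf G X R) :
    (eqSheafification B).obj ((forgetToPresheaf B).obj A) ⟶ A where
  toFun (e : ((forgetToPresheaf B).obj A).Total) := (evalGerm B A e.1 e.2).1
  continuous_toFun := GPresheaf.continuous_of_pt (P := (forgetToPresheaf B).obj A) _
    fun U s => s.2
  p_toFun e := (evalGerm B A e.1 e.2).2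
  map_smul g e := by
    obtain ⟨U, s, x, rfl⟩ := ((forgetToPresheaf B).obj A).exists_pt e
    obtain ⟨W, hW, hWU⟩ := GPresheaf.exists_translate g U x.2
    have h1 := ((forgetToPresheaf B).obj A).smul_pt g s x hW hWU
    refine (congrArg (fun e : ((forgetToPresheaf B).obj A).Total =>
      (evalGerm B A e.1 e.2).1) h1).trans ?_
    change g⁻¹⁻¹ • (s.1 ⟨g⁻¹ • g • x.1, _⟩).1 = g • (s.1 x).1
    rw [inv_inv]
    exact congrArg (g • ·) (A.section_congr s (Subtype.ext (inv_smul_smul g x.1)))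
  isLinearMap_fibre x := by
    constructor
    · intro a b
      obtain ⟨U, s, t, hx, rfl, rfl⟩ := ((forgetToPresheaf B).obj A).exists_ptFibre a b
      apply Subtype.ext
      exact congrArg (fun e : ((forgetToPresheaf B).obj A).Total =>
        (evalGerm B A e.1 e.2).1) 
        (congrArg Subtype.val (GPresheaf.ptFibre_add _ s t hx))
    · intro r a
      obtain ⟨U, s, t, hx, rfl, -⟩ := ((forgetToPresheaf B).obj A).exists_ptFibre a a
      apply Subtype.ext
      exact congrArg (fun e : ((forgetToPresheaf B).obj A).Total =>
        (evalGerm B A e.1 e.2).1) 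
        (congrArg Subtype.val (GPresheaf.ptFibre_smul _ r s hx))

/-- The functor from `G`-presheaves to `R`-modules given by the value at `U ∈ B`. -/
def GPresheaf.evaluation {B : ClopenBasis X} (U : OrbitCat G B) :
    GPresheaf G R B ⥤ ModuleCat.{u} R :=
  (IsDiscretePresheaf G R B).ι ⋙ (CategoryTheory.evaluation _ _).obj (op U)

/-- A cocone of `G`-presheaves is a termwise colimit if its value at each `U ∈ B` is a colimit
of `R`-modules. -/
def IsTermwiseColimit {B : ClopenBasis X} {J : Type u} [SmallCategory J]
    {D : J ⥤ GPresheaf G R B} (c : Cocone D) : Prop :=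
  ∀ U : OrbitCat G B, Nonempty (IsColimit ((GPresheaf.evaluation U).mapCocone c))

/-- The sheafification `ℓ (∏ᴾ F i)` of the presheaf product of the (underlying presheaves of
the) `G`-sheaves `F i`, as a functor of the family `F`. -/
def sheafProd (G X R : Type u) [Group G] [TopologicalSpace G] [IsTopologicalGroup G]
    [TopologicalSpace X] [CompactSpace X] [MulAction G X] [ContinuousSMul G X] [Ring R]
    (B : ClopenBasis X) (I : Type u) : (I → GSheaf G X R) ⥤ GSheaf G X R :=
  Functor.pi (fun _ => forgetToPresheaf B) ⋙ presheafProd B I ⋙ eqSheafification B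

/-- The projection `ℓ (∏ᴾ F i) ⟶ F i`. -/
def sheafProdProj (B : ClopenBasis X) {I : Type u} (F : I → GSheaf G X R) (i : I) :
    (sheafProd G X R B I).obj F ⟶ F i :=
  (eqSheafification B).map (presheafProdProj B (fun i => (forgetToPresheaf B).obj (F i)) i) ≫
    sheafificationCounit B (F i)

end Sheafify
end Sheaves
end

/-!
Fix an open-closed basis `B`. Sending `s ∈ P(U)` to the section `x ↦ s_x` is the unit of an
adjunction between sheafification `ℓ` and the forgetful functor, with the canonical map
`ε : ℓE ⟶ E` as counit (`sheafificationAdjunction`). The counit is an isomorphism, because every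
point of a sheaf space lies on a section over a member of `B`, and two sections with the same
value at a point agree nearby (`bijective_evalGerm`). So `G`-sheaves are a reflective subcategory
of `G`-presheaves. These in turn are a coreflective subcategory of all functors
`O_G(B)ᵒᵖ ⥤ R-mod`, with coreflector `disc` (`discAdjunction`). Hence both categories have all
small limits and colimits; colimits of presheaves are termwise, and colimits of sheaves are
sheafifications of colimits of presheaves.

Products of presheaves are the discrete parts of termwise products (`isLimitPresheafProd`). A
reflective subcategory is closed under products, so the presheaf product of sheaves is isomorphic
to its own sheafification, which is therefore the product of sheaves (`isLimitReflectedFan`).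
Independence of the basis is the uniqueness of products.

For abelianness, addition of maps is transported along the fully faithful functor to presheaves;
it is fibrewise since points lie on sections. The fibre of `ℓP` at `x` is the filtered colimit of
the `P(U)` over the members of `B` containing `x` (`isColimitFibreCocone`), and finite limits of
presheaves are termwise as a finite intersection of open subgroups is open. So the fibre functors
preserve finite limits and all colimits. A map of sheaves which is bijective on fibres is an
isomorphism, since local homeomorphisms are open; thus the comparison from coimage to image is an
isomorphism because it is one for modules on each fibre (`GSheaf.abelian`).
-/

noncomputable section

/-! ### Sheafification as a reflector -/

section SheafAdjunction

variable {G X R : Type u} [Group G] [TopologicalSpace G] [TopologicalSpace X]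
  [MulAction G X] [Ring R]

/-- A map between local homeomorphisms over `X` is itself a local homeomorphism, hence open, so
its inverse is continuous. -/
theorem GSheaf.isIso_of_bijective {A A' : GSheaf G X R} (f : A ⟶ A')
    (hf : Function.Bijective f.toFun) : IsIso f := by
  have hcomp : A'.p ∘ f.toFun = A.p := funext f.p_toFun
  have hloc : IsLocalHomeomorph f.toFun :=
    (hcomp ▸ A.isLocalHomeomorph : IsLocalHomeomorph (A'.p ∘ f.toFun)).of_comp
      A'.isLocalHomeomorph f.continuous_toFun
  let e : A.E ≃ A'.E := Equiv.ofBijective f.toFun hf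
  have he : ∀ b, f.toFun (e.symm b) = b := e.apply_symm_apply
  let g : A' ⟶ A :=
    { toFun := e.symm
      continuous_toFun := (e.toHomeomorphOfContinuousOpen f.continuous_toFun
        hloc.isOpenMap).symm.continuous
      p_toFun := fun b => by rw [← f.p_toFun, he]
      map_smul := fun a b => hf.1 (by rw [he, f.map_smul, he])
      isLinearMap_fibre := fun x => by
        constructor
        · intro a b
          apply Subtype.ext
          apply hf.1
          have h := congrArg Subtype.val ((f.isLinearMap_fibre x).map_add
            ⟨e.symm a.1, by rw [← f.p_toFun, he, a.2]⟩ ⟨e.symm b.1, by rw [← f.p_toFun, he, b.2]⟩)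
          refine (he _).trans (Eq.trans ?_ h.symm)
          exact A'.fibre_add_congr rfl _ _ _ _ (he _).symm (he _).symm
        · intro r a
          apply Subtype.ext
          apply hf.1
          have h := congrArg Subtype.val ((f.isLinearMap_fibre x).map_smul r
            ⟨e.symm a.1, by rw [← f.p_toFun, he, a.2]⟩)
          refine (he _).trans (Eq.trans ?_ h.symm)
          exact A'.fibre_smul_congr rfl _ _ _ (he _).symm }
  exact ⟨g, GSheaf.hom_ext e.symm_apply_apply, GSheaf.hom_ext he⟩

theorem GSheaf.isIso_of_bijective_fibreMap {A A' : GSheaf G X R} (f : A ⟶ A')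
    (hf : ∀ x, Function.Bijective (GSheaf.Hom.fibreMap f x)) : IsIso f := by
  refine GSheaf.isIso_of_bijective f ⟨fun a b h => ?_, fun b => ?_⟩
  · have hp : A.p b = A.p a := by rw [← f.p_toFun, ← f.p_toFun, h]
    exact congrArg Subtype.val ((hf (A.p a)).1 (a₁ := ⟨a, rfl⟩) (a₂ := ⟨b, hp⟩) (Subtype.ext h))
  · obtain ⟨a, ha⟩ := (hf (A'.p b)).2 ⟨b, rfl⟩
    exact ⟨a.1, congrArg Subtype.val ha⟩

variable [IsTopologicalGroup G] [ContinuousSMul G X] [CompactSpace X] (B : ClopenBasis X)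

/-- Every point of a sheaf space lies on a section over a member of the basis. -/
theorem GSheaf.exists_section (A : GSheaf G X R) {x : X} (a : A.Fibre x) :
    ∃ (U : OrbitCat G B) (s : A.sections U.set) (hx : x ∈ U.set), s.1 ⟨x, hx⟩ = a := by
  obtain ⟨a, rfl⟩ := a
  obtain ⟨O, s, hO, hs, hx, hsx⟩ := A.exists_local_section a
  obtain ⟨U, hxU, hUO⟩ := OrbitCat.exists_subset G B hO hx
  exact ⟨U, ⟨fun u => s ⟨u.1, hUO u.2⟩, hs.comp (by fun_prop)⟩, hxU, Subtype.ext hsx⟩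

/-- Two sections with the same value at `x` agree near `x`, as sections are open maps. -/
theorem GSheaf.exists_eqOn (A : GSheaf G X R) {x : X} {U V : OrbitCat G B}
    (hU : x ∈ U.set) (hV : x ∈ V.set) (s : A.sections U.set) (t : A.sections V.set)
    (h : s.1 ⟨x, hU⟩ = t.1 ⟨x, hV⟩) :
    ∃ (W : OrbitCat G B) (_ : x ∈ W.set) (hWU : W.set ⊆ U.set) (hWV : W.set ⊆ V.set),
      ∀ w : W.set, s.1 ⟨w.1, hWU w.2⟩ = t.1 ⟨w.1, hWV w.2⟩ := by
  have h1 : IsOpen ((fun v : V.set => (t.1 v).1) ⁻¹' Set.range fun u => (s.1 u).1) :=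
    (A.isOpen_range_section U.isOpen s).preimage t.2
  obtain ⟨W, hxW, hW⟩ := OrbitCat.exists_subset G B
    (V.isOpen.isOpenMap_subtype_val _ h1) ⟨⟨x, hV⟩, ⟨⟨x, hU⟩, congrArg Subtype.val h⟩, rfl⟩
  have key : ∀ w ∈ W.set, ∃ (hU : w ∈ U.set) (hV : w ∈ V.set), s.1 ⟨w, hU⟩ = t.1 ⟨w, hV⟩ := by
    intro w hw
    obtain ⟨v, ⟨u, hu⟩, rfl⟩ := hW hw
    have huv : u.1 = v.1 := (s.1 u).2.symm.trans ((congrArg A.p hu).trans (t.1 v).2)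
    refine ⟨huv ▸ u.2, v.2, Subtype.ext (Eq.trans ?_ hu)⟩
    exact A.section_congr s (Subtype.ext huv.symm)
  exact ⟨W, hxW, fun w hw => (key w hw).1, fun w hw => (key w hw).2.1,
    fun w => (key w.1 w.2).2.2⟩

/-- The stalk of the presheaf of sections at `x` is the fibre at `x`: surjectivity is the existence
of local sections, injectivity the local agreement of sections with equal values. -/
theorem bijective_evalGerm (A : GSheaf G X R) (x : X) :
    Function.Bijective (evalGerm B A x) := by
  refine ⟨fun a b h => ?_, fun a => ?_⟩
  · obtain ⟨U, hU, s, rfl⟩ := GPresheaf.exists_germ _ a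
    obtain ⟨V, hV, t, rfl⟩ := GPresheaf.exists_germ _ b
    obtain ⟨W, hx, hWU, hWV, hW⟩ := A.exists_eqOn B hU hV s t h
    refine (GPresheaf.germ_eq_iff ..).2 ⟨W, hWU, hWV, hx, A.sections_ext fun w => ?_⟩
    refine congrArg ((1 : G)⁻¹ • ·) ?_
    refine (A.section_congr s (y := ⟨w.1, hWU w.2⟩) (Subtype.ext (one_smul G w.1))).trans ?_
    rw [hW w]
    exact (A.section_congr t (Subtype.ext (one_smul G w.1))).symm
  · obtain ⟨U, s, hx, hs⟩ := A.exists_section B a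
    exact ⟨GPresheaf.germ _ U x hx s, hs⟩

instance isIso_sheafificationCounit (A : GSheaf G X R) : IsIso (sheafificationCounit B A) := by
  refine GSheaf.isIso_of_bijective_fibreMap _ fun x => ?_
  have h := (bijective_evalGerm B A x).comp
    (GPresheaf.fibreEquiv ((forgetToPresheaf B).obj A) x).bijective
  have e : ⇑(GSheaf.Hom.fibreMap (sheafificationCounit B A) x) = evalGerm B A x ∘
      GPresheaf.fibreEquiv ((forgetToPresheaf B).obj A) x := by
    funext ⟨e, he⟩
    subst he
    rfl
  rw [e]
  exact h

/-- The map `P ⟶ (U ↦ Γ(U, ℓP))` sending `s ∈ P(U)` to the section `x ↦ s_x`. -/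
def sheafificationUnit {B : ClopenBasis X} (P : GPresheaf G R B) :
    P ⟶ (forgetToPresheaf B).obj ((eqSheafification B).obj P) :=
  ObjectProperty.homMk
    { app := fun U => ModuleCat.ofHom
        { toFun := fun s => (⟨fun x => P.ptFibre U.unop s x.2, P.continuous_pt U.unop s⟩ :
            P.sheafify.sections U.unop.set)
          map_add' := fun s t => Subtype.ext (funext fun x => (P.ptFibre_add s t x.2).symm)
          map_smul' := fun r s => Subtype.ext (funext fun x => (P.ptFibre_smul r s x.2).symm) }
      naturality := fun U V f => by
        ext s
        refine P.sheafify.sections_ext fun v => ?_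
        have hv : f.unop.1 • v.1 ∈ U.unop.set := f.unop.2 (Set.smul_mem_smul_set v.2)
        have hv' : f.unop.1⁻¹ • f.unop.1 • v.1 ∈ V.unop.set := by
          rw [inv_smul_smul]; exact v.2
        have h : f.unop.1⁻¹⁻¹ • V.unop.set ⊆ U.unop.set := by rw [inv_inv]; exact f.unop.2
        refine Eq.trans ?_ (P.smul_pt f.unop.1⁻¹ s ⟨f.unop.1 • v.1, hv⟩ hv' h).symm
        have e : P.act f.unop.1⁻¹⁻¹ h s = P.act f.unop.1 f.unop.2 s :=
          P.act_congr (inv_inv _) h s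
        rw [e]
        exact congrArg (P.pt V.unop _) (Subtype.ext (inv_smul_smul _ _).symm) }

/-- Sheafification is left adjoint to the forgetful functor; the counit is `s_x ↦ s(x)`. -/
def sheafificationAdjunction :
    eqSheafification (G := G) (R := R) B ⊣ forgetToPresheaf B where
  unit :=
    { app := sheafificationUnit
      naturality := fun P Q φ => by
        ext U s
        rfl }
  counit :=
    { app := sheafificationCounit B
      naturality := fun A A' f => GSheaf.hom_ext fun e => by
        obtain ⟨U, s, x, rfl⟩ := ((forgetToPresheaf B).obj A).exists_pt e
        rfl }
  left_triangle_components P := GSheaf.hom_ext fun e => by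
    obtain ⟨U, s, x, rfl⟩ := P.exists_pt e
    rfl
  right_triangle_components A := by
    ext U s
    rfl

instance isIso_sheafificationAdjunction_counit :
    IsIso (sheafificationAdjunction (G := G) (R := R) B).counit :=
  (NatTrans.isIso_iff_isIso_app _).2 fun A => isIso_sheafificationCounit B A

instance : (forgetToPresheaf (G := G) (R := R) B).Full :=
  (sheafificationAdjunction B).fullyFaithfulROfIsIsoCounit.full

instance : (forgetToPresheaf (G := G) (R := R) B).Faithful :=
  (sheafificationAdjunction B).fullyFaithfulROfIsIsoCounit.faithful

/-- `G`-sheaves are a reflective subcategory of `G`-presheaves. -/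
@[reducible]
def forgetToPresheafReflective : Reflective (forgetToPresheaf (G := G) (R := R) B) where
  L := eqSheafification B
  adj := sheafificationAdjunction B

end SheafAdjunction

/-! ### Limits and colimits of presheaves -/

section PresheafLimits

variable {G X R : Type u} [Group G] [TopologicalSpace G] [TopologicalSpace X]
  [MulAction G X] [Ring R] [IsTopologicalGroup G] [ContinuousSMul G X] [CompactSpace X]
  (B : ClopenBasis X)

/-- A finite limit of discrete presheaves is discrete, since finitely many open subgroups have
an open intersection. -/
instance isClosedUnderLimitsOfShape_isDiscretePresheaf (J : Type) [SmallCategory J]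
    [FinCategory J] : (IsDiscretePresheaf G R B).IsClosedUnderLimitsOfShape J where
  limitsOfShape_le := by
    rintro F ⟨p⟩ U s
    have hc := isLimitOfPreserves ((evaluation _ _).obj (op U)) p.isLimit
    choose H hH hs using fun j => p.prop_diag_obj j U ((p.π.app j).app (op U) s)
    refine ⟨⨅ j, H j, ?_, fun h hh => Concrete.isLimit_ext _ hc _ _ fun j => ?_⟩
    · rw [Subgroup.coe_iInf]
      exact isOpen_iInter_of_finite hH
    · have e := congrArg (fun k => k.hom s) ((p.π.app j).naturality (OrbitCat.ofStab h).op)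
      exact e.trans (hs j h (Subgroup.mem_iInf.1 hh j))

/-- The functor `F ↦ disc F` is right adjoint to the inclusion of presheaves. -/
def discAdjunction : (IsDiscretePresheaf G R B).ι ⊣ disc where
  unit :=
    { app := fun P => ObjectProperty.homMk
        { app := fun U => ModuleCat.ofHom (LinearMap.id.codRestrict (discPart P.obj U.unop)
            fun s => P.property U.unop s)
          naturality := fun _ _ _ => rfl }
      naturality := fun _ _ _ => rfl }
  counit :=
    { app := discι
      naturality := fun _ _ _ => rfl }
  left_triangle_components _ := rfl
  right_triangle_components _ := rfl

instance coreflective_isDiscretePresheaf_ι : Coreflective (IsDiscretePresheaf G R B).ι where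
  R := disc
  adj := discAdjunction B

instance hasColimits_gPresheaf : HasColimits (GPresheaf G R B) :=
  hasColimits_of_coreflective (IsDiscretePresheaf G R B).ι

instance hasLimits_gPresheaf : HasLimits (GPresheaf G R B) :=
  hasLimits_of_coreflective (IsDiscretePresheaf G R B).ι

variable {B}

instance preservesColimits_evaluation (U : OrbitCat G B) :
    PreservesColimits (GPresheaf.evaluation (R := R) U) := by
  have := (discAdjunction (G := G) (R := R) B).leftAdjoint_preservesColimits
  unfold GPresheaf.evaluation
  infer_instance

theorem isTermwiseColimit_of_isColimit {J : Type u} [SmallCategory J] {D : J ⥤ GPresheaf G R B}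
    {c : Cocone D} (hc : IsColimit c) : IsTermwiseColimit c :=
  fun U => ⟨isColimitOfPreserves (GPresheaf.evaluation U) hc⟩

/-- A termwise colimit of `G`-presheaves is a colimit. -/
def IsTermwiseColimit.isColimit {J : Type u} [SmallCategory J] {D : J ⥤ GPresheaf G R B}
    {c : Cocone D} (hc : IsTermwiseColimit c) : IsColimit c :=
  isColimitOfReflects (IsDiscretePresheaf G R B).ι
    (evaluationJointlyReflectsColimits _ fun U => (hc U.unop).some)

/-- The map into `∏ᴾ F i` given by a family of maps into the `F i`: it lands in the discrete part
because its source is discrete. -/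
def presheafProdLift {I : Type u} (F : I → GPresheaf G R B) {P : GPresheaf G R B}
    (f : ∀ i, P ⟶ F i) : P ⟶ (presheafProd B I).obj F :=
  let φ : P.obj ⟶ (termwiseProd B I).obj fun i => (F i).obj :=
    { app := fun U => ModuleCat.ofHom (LinearMap.pi fun i => ((f i).hom.app U).hom)
      naturality := fun U V k => by
        ext s
        funext i
        exact congrArg (fun k => k.hom s) ((f i).hom.naturality k) }
  (discAdjunction B).homEquiv P _ φ

/-- The presheaf product is the product in the category of `G`-presheaves. -/
def isLimitPresheafProd {I : Type u} (F : I → GPresheaf G R B) :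
    IsLimit (Fan.mk ((presheafProd B I).obj F) (presheafProdProj B F)) :=
  Fan.IsLimit.mk _ (fun s => presheafProdLift F s.proj) (fun s i => rfl) (fun s m h => by
    ext U t
    apply Subtype.ext
    funext i
    exact congrArg (fun k => (k.hom.app U).hom t) (h i))

end PresheafLimits

/-! ### Fibres as filtered colimits -/

section FibreFunctor

variable {G X R : Type u} [Group G] [TopologicalSpace G] [TopologicalSpace X]
  [MulAction G X] [Ring R]

/-- The functor sending a `G`-sheaf to its fibre at `x`. -/
def GSheaf.fibreFunctor (G R : Type u) {X : Type u} [Group G] [TopologicalSpace G]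
    [TopologicalSpace X] [MulAction G X] [Ring R] (x : X) : GSheaf G X R ⥤ ModuleCat.{u} R where
  obj A := ModuleCat.of R (A.Fibre x)
  map f := ModuleCat.ofHom (GSheaf.Hom.fibreMap f x)

theorem GSheaf.isIso_of_isIso_fibreFunctor_map {A A' : GSheaf G X R} (f : A ⟶ A')
    (hf : ∀ x, IsIso ((fibreFunctor G R x).map f)) : IsIso f :=
  GSheaf.isIso_of_bijective_fibreMap f fun x =>
    ConcreteCategory.bijective_of_isIso ((fibreFunctor G R x).map f)

variable [IsTopologicalGroup G] [ContinuousSMul G X] [CompactSpace X] (B : ClopenBasis X)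

/-- The basis of all open-closed subsets of a profinite space. -/
def ClopenBasis.allClopens (X : Type u) [TopologicalSpace X] [CompactSpace X] [T2Space X]
    [TotallyDisconnectedSpace X] : ClopenBasis X where
  sets := {U | IsClopen U}
  isBasis := isTopologicalBasis_isClopen
  isClopen _ h := h

/-- The neighbourhoods of `x` in the basis, as a diagram in `O_G(B)ᵒᵖ`. -/
def nhdFunctor (G : Type u) [Group G] [TopologicalSpace G] [MulAction G X] (x : X) :
    GPresheaf.Nhd G B x ⥤ (OrbitCat G B)ᵒᵖ where
  obj U := op U.set
  map {U V} h := (OrbitCat.homMk (U := V.set) (V := U.set) 1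
    ((one_smul G V.set.set).subset.trans (leOfHom h))).op
  map_id _ := rfl
  map_comp _ _ := Quiver.Hom.unop_inj (Subtype.ext (one_mul 1).symm)

/-- The fibre of `ℓP` at `x` as a cocone on the modules `P(U)`, for `x ∈ U`. -/
def fibreCocone {B : ClopenBasis X} (P : GPresheaf G R B) (x : X) :
    Cocone (nhdFunctor B G x ⋙ P.obj) where
  pt := (GSheaf.fibreFunctor G R x).obj ((eqSheafification B).obj P)
  ι :=
    { app := fun U => ModuleCat.ofHom
        { toFun := fun s : P.sec U.set => (P.ptFibre U.set s U.mem : P.sheafify.Fibre x)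
          map_add' := fun s t => (P.ptFibre_add s t U.mem).symm
          map_smul' := fun r s => (P.ptFibre_smul r s U.mem).symm }
      naturality := fun U V h => by
        ext s
        exact Subtype.ext (P.pt_res (leOfHom h) s ⟨x, V.mem⟩) }

/-- The fibre of `ℓP` at `x` is the colimit of the `P(U)` over the neighbourhoods of `x`. -/
def isColimitFibreCocone {B : ClopenBasis X} (P : GPresheaf G R B) (x : X) :
    IsColimit (fibreCocone P x) where
  desc s := ModuleCat.ofHom ((GPresheaf.germLift
    (fun U hx => (s.ι.app ⟨U, hx⟩).hom)
    (fun U V hU hV h t => congrArg (fun k => k.hom t)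
      (s.w (homOfLE (show (⟨U, hU⟩ : GPresheaf.Nhd G B x) ≤ ⟨V, hV⟩ from h))))).comp
    ((P.fibreEquiv x).linearEquiv R).toLinearMap)
  fac s U := rfl
  uniq s m hm := by
    refine ModuleCat.hom_ext (LinearMap.ext fun a => ?_)
    obtain ⟨U, t, -, hx, rfl, -⟩ := P.exists_ptFibre a a
    exact congrArg (fun k => k.hom t) (hm ⟨U, hx⟩)

/-- The fibres of the sheafification are filtered colimits over neighbourhoods. -/
def eqSheafificationCompFibreFunctorIso (x : X) :
    eqSheafification B ⋙ GSheaf.fibreFunctor G R x ≅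
      (IsDiscretePresheaf G R B).ι ⋙
        (Functor.whiskeringLeft _ _ _).obj (nhdFunctor B G x) ⋙ colim :=
  NatIso.ofComponents
    (fun P => (isColimitFibreCocone P x).coconePointUniqueUpToIso (colimit.isColimit _))
    (fun {P Q} φ => (isColimitFibreCocone P x).hom_ext fun U => by
      have h1 := (isColimitFibreCocone P x).comp_coconePointUniqueUpToIso_hom
        (colimit.isColimit _) U
      have h2 := (isColimitFibreCocone Q x).comp_coconePointUniqueUpToIso_hom
        (colimit.isColimit _) U
      have h3 : (fibreCocone P x).ι.app U ≫
          (GSheaf.fibreFunctor G R x).map ((eqSheafification B).map φ) =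
          φ.hom.app (op U.set) ≫ (fibreCocone Q x).ι.app U := rfl
      refine ((Category.assoc _ _ _).symm.trans (congrArg (· ≫ _) h3)).trans ?_
      refine (Category.assoc _ _ _).trans ((congrArg (_ ≫ ·) h2).trans ?_)
      let ψ := ((Functor.whiskeringLeft _ _ _).obj (nhdFunctor B G x)).map φ.hom
      refine Eq.trans ?_ ((congrArg (· ≫ colim.map ψ) h1).symm.trans (Category.assoc _ _ _))
      exact (colimit.ι_map ψ U).symm)

instance preservesFiniteLimits_whiskering_colim (x : X) : PreservesFiniteLimits
    ((IsDiscretePresheaf G R B).ι ⋙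
      (Functor.whiskeringLeft _ _ (ModuleCat.{u} R)).obj (nhdFunctor B G x) ⋙ colim) := by
  have : PreservesFiniteLimits (IsDiscretePresheaf G R B).ι := ⟨fun J _ _ => inferInstance⟩
  have : PreservesFiniteLimits ((Functor.whiskeringLeft _ _ (ModuleCat.{u} R)).obj
    (nhdFunctor B G x)) := ⟨fun J _ _ => inferInstance⟩
  have : PreservesFiniteLimits (colim (J := GPresheaf.Nhd G B x) (C := ModuleCat.{u} R)) :=
    inferInstance
  have := comp_preservesFiniteLimits ((Functor.whiskeringLeft _ _ (ModuleCat.{u} R)).obj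
    (nhdFunctor B G x)) colim
  exact comp_preservesFiniteLimits _ _

instance preservesColimits_whiskering_colim (x : X) : PreservesColimits
    ((IsDiscretePresheaf G R B).ι ⋙
      (Functor.whiskeringLeft _ _ (ModuleCat.{u} R)).obj (nhdFunctor B G x) ⋙ colim) := by
  have := (discAdjunction (G := G) (R := R) B).leftAdjoint_preservesColimits
  infer_instance

/-- The counit of the sheafification adjunction as an isomorphism. -/
def sheafificationCounitIso :
    forgetToPresheaf B ⋙ eqSheafification B ≅ 𝟭 (GSheaf G X R) :=
  asIso (sheafificationAdjunction B).counit

/-- The fibre functor is isomorphic to the forgetful functor, which preserves limits, followed by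
the filtered colimit over neighbourhoods. -/
instance preservesFiniteLimits_fibreFunctor [T2Space X] [TotallyDisconnectedSpace X] (x : X) :
    PreservesFiniteLimits (GSheaf.fibreFunctor G R x) := by
  let B := ClopenBasis.allClopens X
  have h1 := (sheafificationAdjunction (G := G) (R := R) B).rightAdjoint_preservesLimits
  have h2 : PreservesFiniteLimits (eqSheafification B ⋙ GSheaf.fibreFunctor G R x) :=
    preservesFiniteLimits_of_natIso (eqSheafificationCompFibreFunctorIso B x).symm
  have h3 : PreservesFiniteLimits (forgetToPresheaf (G := G) (R := R) B) :=
    PreservesLimits.preservesFiniteLimits _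
  have h4 : PreservesFiniteLimits ((forgetToPresheaf B ⋙ eqSheafification B) ⋙
      GSheaf.fibreFunctor G R x) :=
    comp_preservesFiniteLimits (forgetToPresheaf B)
      (eqSheafification B ⋙ GSheaf.fibreFunctor G R x)
  exact preservesFiniteLimits_of_natIso
    (Functor.isoWhiskerRight (sheafificationCounitIso B) (GSheaf.fibreFunctor G R x))

/-- Colimits of `G`-sheaves are sheafifications of colimits of `G`-presheaves, so fibres commute
with them because the fibres of a sheafification commute with colimits of presheaves. -/
instance preservesColimits_fibreFunctor [T2Space X] [TotallyDisconnectedSpace X] (x : X) :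
    PreservesColimits (GSheaf.fibreFunctor G R x) where
  preservesColimitsOfShape {J _} := ⟨fun {D} => by
    let B := ClopenBasis.allClopens X
    have h1 := (sheafificationAdjunction (G := G) (R := R) B).leftAdjoint_preservesColimits
    have h2 : PreservesColimits (eqSheafification B ⋙ GSheaf.fibreFunctor G R x) :=
      preservesColimits_of_natIso (eqSheafificationCompFibreFunctorIso B x).symm
    have h3 : PreservesColimit (D ⋙ forgetToPresheaf B ⋙ eqSheafification B)
        (GSheaf.fibreFunctor G R x) :=
      preservesColimit_of_preserves_colimit_cocone
        (K := (D ⋙ forgetToPresheaf B) ⋙ eqSheafification B)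
        (isColimitOfPreserves (eqSheafification B) (colimit.isColimit (D ⋙ forgetToPresheaf B)))
        (isColimitOfPreserves (eqSheafification B ⋙ GSheaf.fibreFunctor G R x)
          (colimit.isColimit (D ⋙ forgetToPresheaf B)))
    exact preservesColimit_of_iso_diagram _
      (Functor.isoWhiskerLeft D (sheafificationCounitIso B))⟩

end FibreFunctor

/-! ### The abelian structure on sheaves -/

section Abelian

variable {G X R : Type u} [Group G] [TopologicalSpace G] [TopologicalSpace X]
  [MulAction G X] [Ring R] [IsTopologicalGroup G] [ContinuousSMul G X] [CompactSpace X]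

theorem hasLimits_gSheaf (B : ClopenBasis X) : HasLimits (GSheaf G X R) :=
  have := forgetToPresheafReflective (G := G) (R := R) B
  hasLimits_of_reflective (forgetToPresheaf B)

theorem hasColimits_gSheaf (B : ClopenBasis X) : HasColimits (GSheaf G X R) :=
  have := forgetToPresheafReflective (G := G) (R := R) B
  hasColimits_of_reflective (forgetToPresheaf B)

/-- The preadditive structure on `G`-sheaves which makes the fully faithful functor to
`G`-presheaves additive. -/
@[reducible]
def GSheaf.preadditive (B : ClopenBasis X) : Preadditive (GSheaf G X R) :=
  .ofFullyFaithful (Functor.FullyFaithful.ofFullyFaithful (forgetToPresheaf B))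

/-- Addition of maps is fibrewise: it is so on sections by definition, and every point of a sheaf
space lies on a section. -/
theorem GSheaf.preadditive_fibreMap_add (B : ClopenBasis X) {A A' : GSheaf G X R}
    (f f' : A ⟶ A') (x : X) (a : A.Fibre x) :
    letI := GSheaf.preadditive (G := G) (R := R) B
    GSheaf.Hom.fibreMap (f + f') x a =
      GSheaf.Hom.fibreMap f x a + GSheaf.Hom.fibreMap f' x a := by
  let := GSheaf.preadditive (G := G) (R := R) B
  obtain ⟨U, s, hx, rfl⟩ := A.exists_section B a
  have : (forgetToPresheaf (G := G) (R := R) B).Additive :=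
    (Functor.FullyFaithful.ofFullyFaithful (forgetToPresheaf B)).additive_ofFullyFaithful
  have h := (forgetToPresheaf B).map_add (f := f) (g := f')
  exact congrArg (fun k => ((k.hom.app (op U)).hom s : A'.sections U.set).1 ⟨x, hx⟩) h

/-- `G`-sheaves over a profinite space form an abelian category: the fibre functors are exact and
jointly reflect isomorphisms, so that the comparison from the coimage to the image of a map is
an isomorphism. -/
@[reducible]
def GSheaf.abelian [T2Space X] [TotallyDisconnectedSpace X] (B : ClopenBasis X) :
    Abelian (GSheaf G X R) := by
  let := GSheaf.preadditive (G := G) (R := R) B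
  have := hasLimits_gSheaf (G := G) (R := R) B
  have := hasColimits_gSheaf (G := G) (R := R) B
  have hadd (x : X) : (fibreFunctor G R x).Additive :=
    ⟨fun {_ _ f f'} => ModuleCat.hom_ext
      (LinearMap.ext (GSheaf.preadditive_fibreMap_add B f f' x))⟩
  have hcomp {A A' : GSheaf G X R} (f : A ⟶ A') : IsIso (Abelian.coimageImageComparison f) :=
    isIso_of_isIso_fibreFunctor_map _ fun x => IsIso.of_isIso_fac_right
      (Abelian.PreservesCoimage.hom_coimageImageComparison (fibreFunctor G R x) f).symm
  exact Abelian.ofCoimageImageComparisonIsIso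

end Abelian

/-! ### Colimits of sheaves -/

section SheafColimits

variable {G X R : Type u} [Group G] [TopologicalSpace G] [TopologicalSpace X]
  [MulAction G X] [Ring R] [IsTopologicalGroup G] [ContinuousSMul G X] [CompactSpace X]

/-- The maps `D j ⟶ ℓ(C)` given by a cocone `c` with point `C` on the underlying presheaves:
`ε⁻¹` followed by `ℓ(c j)`. -/
def sheafifiedCoconeι {B : ClopenBasis X} {J : Type u} [SmallCategory J] {D : J ⥤ GSheaf G X R}
    (c : Cocone (D ⋙ forgetToPresheaf B)) :
    D ⟶ (Functor.const J).obj ((eqSheafification B).obj c.pt) :=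
  (Functor.isoWhiskerLeft D (sheafificationCounitIso B)).inv ≫ ((eqSheafification B).mapCocone c).ι

theorem counit_comp_sheafifiedCoconeι {B : ClopenBasis X} {J : Type u} [SmallCategory J]
    {D : J ⥤ GSheaf G X R} (c : Cocone (D ⋙ forgetToPresheaf B)) (j : J) :
    sheafificationCounit B (D.obj j) ≫ (sheafifiedCoconeι c).app j =
      (eqSheafification B).map (c.ι.app j) :=
  ((sheafificationCounitIso B).app (D.obj j)).hom_inv_id_assoc _

/-- A colimit of the underlying presheaves sheafifies to a colimit of sheaves. -/
def isColimitSheafifiedCocone {B : ClopenBasis X} {J : Type u} [SmallCategory J]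
    {D : J ⥤ GSheaf G X R} {c : Cocone (D ⋙ forgetToPresheaf B)} (hc : IsColimit c) :
    IsColimit (Cocone.mk ((eqSheafification B).obj c.pt) (sheafifiedCoconeι c)) :=
  have := (sheafificationAdjunction (G := G) (R := R) B).leftAdjoint_preservesColimits
  (IsColimit.precomposeInvEquiv (Functor.isoWhiskerLeft D (sheafificationCounitIso B)) _).symm
    (isColimitOfPreserves (eqSheafification B) hc)

end SheafColimits

/-! ### Products of sheaves -/

section SheafProducts

/-- In a reflective subcategory `D ⊆ C`, products may be computed by reflecting a product taken
in `C`: that product is already isomorphic to its reflection, because `D` is closed under products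
in `C`. -/
def isLimitReflectedFan {C D : Type*} [Category* C] [Category* D] {L : C ⥤ D} {R : D ⥤ C}
    (adj : L ⊣ R) [R.Full] [R.Faithful] {I : Type*} (F : I → D) [HasProduct F]
    {P : C} (π : ∀ i, P ⟶ R.obj (F i)) (h : IsLimit (Fan.mk P π)) :
    IsLimit (Fan.mk (L.obj P) fun i => L.map (π i) ≫ adj.counit.app (F i)) := by
  have := adj.rightAdjoint_preservesLimits
  have e : P ≅ R.obj (∏ᶜ F) := h.conePointUniqueUpToIso
    (isLimitFanMkObjOfIsLimit R F _ (productIsProduct F))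
  have hη : IsIso (adj.unit.app P) := adj.isIso_unit_app_of_iso e
  refine isLimitOfIsLimitFanMkObj R F _
    (h.ofIsoLimit (Fan.ext (asIso (adj.unit.app P)) fun i => ?_))
  simp

variable {G X R : Type u} [Group G] [TopologicalSpace G] [TopologicalSpace X]
  [MulAction G X] [Ring R] [IsTopologicalGroup G] [ContinuousSMul G X] [CompactSpace X]

/-- The sheafification of the presheaf product is the product of sheaves. -/
def isLimitSheafProd (B : ClopenBasis X) {I : Type u} (F : I → GSheaf G X R) :
    IsLimit (Fan.mk ((sheafProd G X R B I).obj F) (sheafProdProj B F)) :=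
  have := hasLimits_gSheaf (G := G) (R := R) B
  isLimitReflectedFan (sheafificationAdjunction B) F _
    (isLimitPresheafProd fun i => (forgetToPresheaf B).obj (F i))

theorem sheafProd_map_proj (B : ClopenBasis X) {I : Type u} {F F' : I → GSheaf G X R}
    (f : F ⟶ F') (i : I) :
    (sheafProd G X R B I).map f ≫ sheafProdProj B F' i = sheafProdProj B F i ≫ f i :=
  GSheaf.hom_ext fun e => by
    obtain ⟨U, s, x, rfl⟩ := GPresheaf.exists_pt _ e
    rfl

/-- The comparison of the products formed with two bases, as products of the same sheaves. -/
def sheafProdIso (B B' : ClopenBasis X) (I : Type u) :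
    sheafProd G X R B I ≅ sheafProd G X R B' I :=
  NatIso.ofComponents
    (fun F => (isLimitSheafProd B F).conePointUniqueUpToIso (isLimitSheafProd B' F))
    (fun {F F'} f => Fan.IsLimit.hom_ext (isLimitSheafProd B' F') _ _ fun i => by
      have h (F : I → GSheaf G X R) := (isLimitSheafProd B F).conePointUniqueUpToIso_hom_comp
        (isLimitSheafProd B' F) ⟨i⟩
      refine (Category.assoc _ _ _).trans ((congrArg (_ ≫ ·) (h F')).trans ?_)
      refine (sheafProd_map_proj B f i).trans ?_
      refine Eq.trans (congrArg (· ≫ f i) (h F).symm) ?_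
      refine (Category.assoc _ _ _).trans (Eq.trans ?_ (Category.assoc _ _ _).symm)
      exact congrArg (_ ≫ ·) (sheafProd_map_proj B' f i).symm)

theorem sheafProdIso_hom_proj (B B' : ClopenBasis X) {I : Type u} (F : I → GSheaf G X R) (i : I) :
    (sheafProdIso B B' I).hom.app F ≫ sheafProdProj B' F i = sheafProdProj B F i :=
  (isLimitSheafProd B F).conePointUniqueUpToIso_hom_comp (isLimitSheafProd B' F) ⟨i⟩

end SheafProducts
end

theorem theorem5p6 (G X R : Type u)
    [Group G] [TopologicalSpace G] [IsTopologicalGroup G]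
    [CompactSpace G] [T2Space G] [TotallyDisconnectedSpace G]
    [TopologicalSpace X] [CompactSpace X] [T2Space X] [TotallyDisconnectedSpace X]
    [MulAction G X] [ContinuousSMul G X] [Ring R] :
    -- abelian, for the fibrewise addition of maps
    (∃ _ : Abelian (GSheaf G X R), ∀ (A A' : GSheaf G X R) (f f' : A ⟶ A') (x : X)
      (a : A.Fibre x), GSheaf.Hom.fibreMap (f + f') x a =
        GSheaf.Hom.fibreMap f x a + GSheaf.Hom.fibreMap f' x a) ∧
    -- all small limits and colimits
    HasLimits (GSheaf G X R) ∧ HasColimits (GSheaf G X R) ∧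
    -- colimits are the sheafifications of termwise colimits of presheaves
    (∀ (B : ClopenBasis X) (J : Type u) [SmallCategory J] (D : J ⥤ GSheaf G X R),
      (∃ c : Cocone (D ⋙ forgetToPresheaf B), IsTermwiseColimit c) ∧
      ∀ c : Cocone (D ⋙ forgetToPresheaf B), IsTermwiseColimit c →
        Nonempty (IsColimit c) ∧
        ∃ ι : D ⟶ (Functor.const J).obj ((eqSheafification B).obj c.pt),
          (∀ j, sheafificationCounit B (D.obj j) ≫ ι.app j = (eqSheafification B).map (c.ι.app j)) ∧
          Nonempty (IsColimit (Cocone.mk ((eqSheafification B).obj c.pt) ι))) ∧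
    -- products are the sheafifications of the presheaf products `disc (∏ i, F i (U))`
    (∀ (B : ClopenBasis X) (I : Type u) (F : I → GSheaf G X R),
      Nonempty (IsLimit (Fan.mk
        ((presheafProd B I).obj fun i => (forgetToPresheaf B).obj (F i))
        (presheafProdProj B fun i => (forgetToPresheaf B).obj (F i)))) ∧
      Nonempty (IsLimit (Fan.mk ((sheafProd G X R B I).obj F) (sheafProdProj B F)))) ∧
    -- independence of the basis, up to natural isomorphism
    (∀ (B B' : ClopenBasis X) (I : Type u),
      ∃ φ : sheafProd G X R B I ≅ sheafProd G X R B' I,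
        ∀ (F : I → GSheaf G X R) (i : I),
          φ.hom.app F ≫ sheafProdProj B' F i = sheafProdProj B F i) := by
  let B₀ := ClopenBasis.allClopens X
  refine ⟨⟨GSheaf.abelian B₀, fun _ _ => GSheaf.preadditive_fibreMap_add B₀⟩, hasLimits_gSheaf B₀,
    hasColimits_gSheaf B₀, fun B J _ D => ⟨⟨colimit.cocone _, isTermwiseColimit_of_isColimit
      (colimit.isColimit _)⟩, fun c hc => ⟨⟨hc.isColimit⟩, sheafifiedCoconeι c,
      counit_comp_sheafifiedCoconeι c, ⟨isColimitSheafifiedCocone hc.isColimit⟩⟩⟩,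
    fun B I F => ⟨⟨isLimitPresheafProd _⟩, ⟨isLimitSheafProd B F⟩⟩,
    fun B B' I => ⟨sheafProdIso B B' I, sheafProdIso_hom_proj B B'⟩⟩
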